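/- Let $F=\mathbb F_q$ be a finite field of characteristic $\ne 2$, let $t\mapsto\varepsilon^t$ be a nontrivial character of the additive group of $F$ with values in $\mathbb C^*$, and fix a nonsquare $\delta\in F^*$. Setting. Consider one of the series $B_n$ ($M=2n+1$, group $O(M)$), $C_n$ ($M=2n$, group $Sp(M)$), $D_n$ ($M=2n$, group $O(M)$), $n\ge 0$. Rows and columns of $M\times M$ matrices are numbered by $I=[-n,n]$ (for $B_n$) or $I=[-n,n]\setminus\{0\}$ (for $C_n,D_n$), in decreasing order. Let $I=I_\ell\sqcup\dots\sqcup I_0\sqcup\dots\sqcup I_{-\ell}$ be a partition into consecutive segments, symmetric with respect to zero ($I_{-k}=-I_k$; $I_0$ may be empty if $0\notin I$). Let $\mathfrak p$ be the algebra of block upper triangular matrices, $\mathcal U_+$ and $\mathcal U_-$ the spaces of strictly block upper and strictly block lower triangular matrices. The associative algebra $\mathfrak{gl}^a=\mathfrak p\oplus\mathcal U_-^a$ has the product $(x+\lambda)(y+\mu)=xy+\mathrm{pr}_{\mathcal U_-}(x\mu+\lambda y)$ for $x,y\in\mathfrak p$, $\lambda,\mu\in\mathcal U_-$ (equivalently,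 $\mathcal U_-\cong\mathcal U_+^*$ via the trace form, as a bimodule with square zero). Its group of invertible elements is the parabolic contraction $\mathbf G^a$ of $GL(M,F)$. Let $X^\dagger=JX^tJ^{-1}$, where $J=\mathbb I_M$ has ones on the antidiagonal and zeros elsewhere for $B_n,D_n$, and $J=\begin{pmatrix}0&\mathbb I_n\\-\mathbb I_n&0\end{pmatrix}$ for $C_n$; this is an involutive antiautomorphism of $\mathfrak{gl}^a$. Put $\mathcal U^a=\mathcal U_+\oplus\mathcal U_-^a$, $U^a=\{u\in 1+\mathcal U^a: u^\dagger=u^{-1}\}$ and $\mathfrak u^a=\{X\in\mathcal U^a:X^\dagger=-X\}$. The group $\mathbf G^a$ acts on $\mathfrak u^a$ by $g\centerdot X=gXg^\dagger$ and on $(\mathfrak u^a)^*$ by $(g\centerdot\lambda)(X)=\lambda(g^\dagger Xg)$ (products in $\mathfrak{gl}^a$). The Cayley map $f:U^a\to\mathfrak u^a$ is $f(u)=2(u-1)(u+1)^{-1}$. Basic pairs. Attach to the positive roots the pairs $(i,j)\in I\times I$ with $i>|j|$ and, for $C_n$, also $(i,-i)$ with $i>0$; to negative roots attach the transposed pairs.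 For $\gamma=(i,j)$ let $\gamma'=(-j,-i)$. Let $\Delta(\mathfrak u^a)$ be the set of those root pairs $\gamma=(i,j)$ for which $i$ and $j$ lie in different segments. The root vectors $\mathcal E_\gamma=E_\gamma$ if $\gamma=\gamma'$ and $\mathcal E_\gamma=E_\gamma-E_\gamma^\dagger$ otherwise ($E_\gamma$ the matrix unit) form a basis of $\mathfrak u^a$; let $\mathcal E_\gamma^*$ be the dual basis. A basic pair $(D,\phi)$ consists of a subset $D\subset\Delta(\mathfrak u^a)$ such that $D\cup D'$ has at most one pair in every row and in every column, and a map $\phi:D\to F^*$ such that: for $B_n$ and $D_n$, $\phi=1$ identically; for $C_n$, $\phi(\gamma)\in\{1,\delta\}$, $\phi(\gamma)=\delta$ only if $\gamma$ is antidiagonal (of the form $(i,-i)$), and for every $k$ the set $D\cap(I_k\times I_{-k})$ is contained in the antidiagonal and has at most one root with $\phi(\gamma)=\delta$. Put $\mathcal X_{D,\phi}=\sum_{\gamma\in D}\phi(\gamma)\mathcal E_\gamma$, $\Lambda_{D,\phi}=\sum_{\gamma\in D}\phi(\gamma)\mathcal E^*_\gamma$, $$\sigma_{D,\phi}(u)=\sum_{\mu\in\mathbf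 G^a\centerdot\Lambda_{D,\phi}}\varepsilon^{\mu(f(u))}\quad(u\in U^a),\qquad K_{D,\phi}=f^{-1}(\mathbf G^a\centerdot\mathcal X_{D,\phi}).$$ Theorem. The set of functions $\{\sigma_{D,\phi}\}$ and the set of classes $\{K_{D,\phi}\}$, where $(D,\phi)$ runs through all basic pairs, form a supercharacter theory of the group $U^a$. That is: the $\sigma_{D,\phi}$ are characters of nonzero finite-dimensional complex representations of $U^a$; distinct functions among them are disjoint (have no common irreducible constituent); the distinct subsets $K_{D,\phi}$ form a partition of $U^a$; the number of distinct functions $\sigma_{D,\phi}$ equals the number of distinct classes $K_{D,\phi}$; every $\sigma_{D,\phi}$ is constant on every class; and $\{1\}$ is one of the classes. -/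

import Mathlib

namespace ParabolicContraction

noncomputable section

/-! ### Supercharacter theories -/

/-- `χ` is the character of a nonzero finite-dimensional complex representation of `G`. -/
def IsCharacter {G : Type*} [Group G] (χ : G → ℂ) : Prop :=
  ∃ (d : ℕ) (ρ : Representation ℂ G (Fin d → ℂ)), 0 < d ∧ ∀ g, χ g = ρ.character g

/-- The characters `χ` and `ψ` are disjoint: representations affording them have no common
constituent, i.e. every intertwining map between them vanishes. -/
def CharDisjoint {G : Type*} [Group G] (χ ψ : G → ℂ) : Prop :=
  ∀ (d e : ℕ) (ρ : Representation ℂ G (Fin d → ℂ)) (τ : Representation ℂ G (Fin e → ℂ)),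
    (∀ g, χ g = ρ.character g) → (∀ g, ψ g = τ.character g) →
      ∀ f : (Fin d → ℂ) →ₗ[ℂ] (Fin e → ℂ), (∀ g v, f (ρ g v) = τ g (f v)) → f = 0

/-- `(S, K)` is a supercharacter theory of the (finite) group `G`: `S` is a system of pairwise
disjoint characters, `K` is a partition of `G` into the same number of subsets, the members of `S`
are constant on the members of `K`, and `{1}` is a member of `K`. -/
structure IsSupercharacterTheory {G : Type*} [Group G] (S : Set (G → ℂ)) (K : Set (Set G)) :
    Prop where
  isCharacter : ∀ χ ∈ S, IsCharacter χ
  pairwise_disjoint : S.Pairwise CharDisjoint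
  isPartition : Setoid.IsPartition K
  encard_eq : S.encard = K.encard
  constant : ∀ χ ∈ S, ∀ C ∈ K, ∀ g ∈ C, ∀ h ∈ C, χ g = χ h
  one_mem : {1} ∈ K

/-! ### Rows, columns, and symmetric partitions into segments -/

/-- The three series: `B n` for `O(2n+1)`, `C n` for `Sp(2n)`, `D n` for `O(2n)`. -/
inductive Series
  | B
  | C
  | D
deriving DecidableEq

/-- The labels of rows and columns: `[-n, n]` for `B n`, and `[-n, n] \ {0}` for `C n` and `D n`.
Rows and columns are listed in decreasing order. -/
def labels (t : Series) (n : ℕ) : Finset ℤ :=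
  match t with
  | Series.B => Finset.Icc (-(n : ℤ)) n
  | Series.C => (Finset.Icc (-(n : ℤ)) n).erase 0
  | Series.D => (Finset.Icc (-(n : ℤ)) n).erase 0

abbrev Idx (t : Series) (n : ℕ) : Type := {i : ℤ // i ∈ labels t n}

variable {t : Series} {n : ℕ}

instance : Neg (Idx t n) :=
  ⟨fun i => ⟨-i.1, by
    have h := i.2
    cases t <;> simp only [labels, Finset.mem_erase, Finset.mem_Icc] at h ⊢ <;> omega⟩⟩

@[simp] theorem coe_neg (i : Idx t n) : ((-i : Idx t n) : ℤ) = -(i : ℤ) := rfl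

instance : InvolutiveNeg (Idx t n) where
  neg_neg i := Subtype.ext (by simp)

/-- A partition of the labels into consecutive segments `I_ℓ, …, I_0, …, I_{-ℓ}` (listed in
decreasing order) which is symmetric with respect to zero, recorded by the map sending a label to
the number of its segment: `I_k = {i | block i = k}`. The segment `I_0` may be empty if `0` is not a
label. -/
structure SymPartition (t : Series) (n : ℕ) where
  block : Idx t n → ℤ
  mono : ∀ i j : Idx t n, (i : ℤ) ≤ j → block i ≤ block j
  symm : ∀ i : Idx t n, block (-i) = -block i

/-! ### The contracted associative algebra `𝔤𝔩ᵃ(M) = 𝔭 ⊕ 𝔲₋ᵃ` of the partition -/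

/-- The elements of `𝔤𝔩ᵃ(M) = 𝔭 ⊕ 𝔲₋ᵃ`, realized as `M × M` matrices: `𝔭` consists of the block upper
triangular matrices, `𝔲₋` of the strictly block lower triangular ones (rows and columns are listed
in decreasing order). The multiplication is the contracted one below. -/
def Contracted (_P : SymPartition t n) (F : Type*) : Type _ := Matrix (Idx t n) (Idx t n) F

section Algebra

variable {F : Type*} [Field F] {P : SymPartition t n}

instance : AddCommGroup (Contracted P F) :=
  inferInstanceAs (AddCommGroup (Matrix (Idx t n) (Idx t n) F))

instance : Module F (Contracted P F) :=
  inferInstanceAs (Module F (Matrix (Idx t n) (Idx t n) F))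

@[simp] theorem add_entry (A B : Contracted P F) (i j) : (A + B) i j = A i j + B i j := rfl
@[simp] theorem sub_entry (A B : Contracted P F) (i j) : (A - B) i j = A i j - B i j := rfl
@[simp] theorem neg_entry (A : Contracted P F) (i j) : (-A) i j = -A i j := rfl
@[simp] theorem zero_entry (i j) : (0 : Contracted P F) i j = 0 := rfl
@[simp] theorem smul_entry (c : F) (A : Contracted P F) (i j) : (c • A) i j = c * A i j := rfl

@[ext] theorem Contracted.ext {A B : Contracted P F} (h : ∀ i j, A i j = B i j) : A = B :=
  Matrix.ext h

/-- The component in `𝔭` (block upper triangular part). -/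
def upper (P : SymPartition t n) (A : Matrix (Idx t n) (Idx t n) F) :
    Matrix (Idx t n) (Idx t n) F :=
  fun i j => if P.block j ≤ P.block i then A i j else 0

/-- The component in `𝔲₋` (strictly block lower triangular part). -/
def lower (P : SymPartition t n) (A : Matrix (Idx t n) (Idx t n) F) :
    Matrix (Idx t n) (Idx t n) F :=
  fun i j => if P.block i < P.block j then A i j else 0

/-- `(x + λ)(y + μ) = xy + (xμ + λy)` for `x, y ∈ 𝔭` and `λ, μ ∈ 𝔲₋ᵃ`, where `xμ` and `λy` are the
matrix products projected to `𝔲₋`. Under the identification of `𝔲₋` with the dual of `𝔲₊` by the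
trace form, `xμ` is the functional `y ↦ μ (yx)` and `λy` the functional `x ↦ λ (yx)`. -/
instance : Mul (Contracted P F) where
  mul A B := upper P A * upper P B + lower P (upper P A * lower P B + lower P A * upper P B)

instance : One (Contracted P F) where
  one := (1 : Matrix (Idx t n) (Idx t n) F)

theorem one_entry (i j) : (1 : Contracted P F) i j = if i = j then 1 else 0 :=
  Matrix.one_apply

theorem mul_entry_def (A B : Contracted P F) (i k) :
    (A * B) i k = (upper P A * upper P B) i k +
      lower P (upper P A * lower P B + lower P A * upper P B) i k := rfl

/-- The condition on block numbers `a, b, c` under which entries in blocks `(a, b)` and `(b, c)`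
contribute to a product. -/
def Composable (a b c : ℤ) : Prop := (b ≤ a ∧ c ≤ b) ∨ (a < c ∧ ¬ (a < b ∧ b < c))

instance (a b c : ℤ) : Decidable (Composable a b c) := by unfold Composable; infer_instance

theorem mul_entry (A B : Contracted P F) (i k) :
    (A * B) i k =
      ∑ j, if Composable (P.block i) (P.block j) (P.block k) then A i j * B j k else 0 := by
  rw [mul_entry_def, lower, Matrix.add_apply, Matrix.mul_apply, Matrix.mul_apply, Matrix.mul_apply]
  split_ifs with h
  · rw [← Finset.sum_add_distrib, ← Finset.sum_add_distrib]
    refine Finset.sum_congr rfl fun j _ => ?_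
    simp only [upper, lower]
    split_ifs <;> first | (exfalso; unfold Composable at *; omega) | simp
  · rw [add_zero]
    refine Finset.sum_congr rfl fun j _ => ?_
    simp only [upper]
    split_ifs <;> first | (exfalso; unfold Composable at *; omega) | simp

instance : Ring (Contracted P F) where
  __ := (inferInstance : AddCommGroup (Contracted P F))
  left_distrib A B C := by
    ext i k
    simp only [mul_entry, add_entry, ← Finset.sum_add_distrib]
    refine Finset.sum_congr rfl fun j _ => ?_
    split_ifs <;> ring
  right_distrib A B C := by
    ext i k
    simp only [mul_entry, add_entry, ← Finset.sum_add_distrib]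
    refine Finset.sum_congr rfl fun j _ => ?_
    split_ifs <;> ring
  zero_mul A := by ext i k; simp [mul_entry]
  mul_zero A := by ext i k; simp [mul_entry]
  one_mul A := by
    ext i k
    rw [mul_entry, Finset.sum_eq_single i]
    · rw [if_pos (by unfold Composable; omega)]; simp [one_entry]
    · intro j _ hj; simp [one_entry, hj.symm]
    · simp
  mul_one A := by
    ext i k
    rw [mul_entry, Finset.sum_eq_single k]
    · rw [if_pos (by unfold Composable; omega)]; simp [one_entry]
    · intro j _ hj; simp [one_entry, hj]
    · simp
  mul_assoc A B C := by
    ext i l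
    simp only [mul_entry, Finset.sum_mul, Finset.mul_sum, ite_mul, mul_ite, zero_mul, mul_zero]
    have h1 : ∀ k : Idx t n, (if Composable (P.block i) (P.block k) (P.block l) then
        ∑ j, (if Composable (P.block i) (P.block j) (P.block k) then A i j * B j k * C k l else 0)
        else 0) = ∑ j, (if Composable (P.block i) (P.block k) (P.block l) ∧
          Composable (P.block i) (P.block j) (P.block k) then A i j * B j k * C k l else 0) := by
      intro k
      by_cases h : Composable (P.block i) (P.block k) (P.block l) <;> simp [h]
    have h2 : ∀ j : Idx t n, (if Composable (P.block i) (P.block j) (P.block l) then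
        ∑ k, (if Composable (P.block j) (P.block k) (P.block l) then A i j * (B j k * C k l) else 0)
        else 0) = ∑ k, (if Composable (P.block i) (P.block j) (P.block l) ∧
          Composable (P.block j) (P.block k) (P.block l) then A i j * (B j k * C k l) else 0) := by
      intro j
      by_cases h : Composable (P.block i) (P.block j) (P.block l) <;> simp [h]
    simp only [h1, h2]
    rw [Finset.sum_comm]
    refine Finset.sum_congr rfl fun j _ => Finset.sum_congr rfl fun k _ => ?_
    rw [mul_assoc]
    refine if_congr ?_ rfl rfl
    unfold Composable
    omega

instance : Algebra F (Contracted P F) :=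
  Algebra.ofModule
    (fun c A B => by
      ext i k
      simp only [mul_entry, smul_entry, Finset.mul_sum, mul_ite, mul_zero, mul_assoc])
    (fun c A B => by
      ext i k
      simp only [mul_entry, smul_entry, Finset.mul_sum, mul_ite, mul_zero, mul_left_comm])

/-! ### The involutive antiautomorphism -/

/-- The sign of a label: `-1` for negative labels in the symplectic case, `1` otherwise. -/
def sign (F : Type*) [Field F] (i : Idx t n) : F := if t = Series.C ∧ (i : ℤ) < 0 then -1 else 1

theorem sign_mul_self (i : Idx t n) : sign F i * sign F i = 1 := by
  unfold sign; split_ifs <;> ring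

theorem sign_mul_sign_neg (i : Idx t n) :
    sign F i * sign F (-i) = if t = Series.C then -1 else 1 := by
  rcases eq_or_ne t Series.C with ht | ht
  · subst ht
    have hl : (i : ℤ) ≠ 0 := by
      have := i.2
      simp only [labels, Finset.mem_erase] at this
      exact this.1
    rcases lt_or_gt_of_ne hl with h | h
    · have h' : ¬ ((-i : Idx Series.C n) : ℤ) < 0 := by simp; omega
      simp [sign, h, -coe_neg, h']
    · have h' : ((-i : Idx Series.C n) : ℤ) < 0 := by simp; omega
      have h'' : ¬ (i : ℤ) < 0 := by omega
      simp [sign, h'', -coe_neg, h']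
  · simp [sign, ht]

theorem sign_neg_mul_sign_neg (i j : Idx t n) :
    sign F (-j) * sign F (-i) = sign F i * sign F j := by
  have hi := sign_mul_sign_neg (F := F) i
  have hj := sign_mul_sign_neg (F := F) j
  have ki := sign_mul_self (F := F) i
  have kj := sign_mul_self (F := F) j
  have e : (sign F i * sign F (-i)) * (sign F j * sign F (-j)) = 1 := by
    rw [hi, hj]; split_ifs <;> ring
  linear_combination (sign F i * sign F j) * e - sign F (-j) * sign F (-i) * ki * sign F j ^ 2
    - sign F (-j) * sign F (-i) * kj

/-- The matrix of the form: it has the entry `sign i` at `(i, -i)`. For `B n` and `D n` it is the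
matrix with units on the antidiagonal, and for `C n` it is `[[0, I], [-I, 0]]` for the `n × n`
matrix `I` with units on the antidiagonal. -/
def formMatrix (F : Type*) [Field F] (t : Series) (n : ℕ) : Matrix (Idx t n) (Idx t n) F :=
  fun i j => if j = -i then sign F i else 0

/-- The involutive antiautomorphism `A ↦ A† = J Aᵀ J⁻¹`, where `J` is the matrix of the form
(see `dag_eq`). -/
def dag (A : Contracted P F) : Contracted P F :=
  fun i j => sign F i * sign F j * A (-j) (-i)

theorem dag_entry (A : Contracted P F) (i j) : dag A i j = sign F i * sign F j * A (-j) (-i) := rfl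

theorem dag_eq (A : Contracted P F) :
    (dag A : Matrix (Idx t n) (Idx t n) F) =
      formMatrix F t n * Matrix.transpose A * (formMatrix F t n)⁻¹ := by
  have h1 : formMatrix F t n * (formMatrix F t n).transpose = 1 := by
    ext i k
    rw [Matrix.mul_apply, Finset.sum_eq_single (-i)]
    · by_cases h : i = k
      · subst h; simp [formMatrix, sign_mul_self]
      · have : ¬ (-i = -k) := fun h' => h (neg_injective h')
        simp [formMatrix, h]
    · intro j _ hj; simp [formMatrix, hj]
    · simp
  rw [Matrix.inv_eq_right_inv h1]
  ext i k
  rw [Matrix.mul_apply, Finset.sum_eq_single (-k)]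
  · rw [Matrix.mul_apply, Finset.sum_eq_single (-i)]
    · simp only [formMatrix, Matrix.transpose_apply, if_true]
      change sign F i * sign F k * A (-k) (-i) = sign F i * A (-k) (-i) * sign F k
      ring
    · intro j _ hj; simp [formMatrix, hj]
    · simp
  · intro j _ hj; simp [formMatrix, hj]
  · simp

@[simp] theorem dag_dag (A : Contracted P F) : dag (dag A) = A := by
  ext i j
  simp only [dag_entry, neg_neg]
  rw [sign_neg_mul_sign_neg, ← mul_assoc, mul_mul_mul_comm, sign_mul_self, sign_mul_self, one_mul, one_mul]

@[simp] theorem dag_add (A B : Contracted P F) : dag (A + B) = dag A + dag B := by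
  ext i j; simp only [dag_entry, add_entry]; ring

@[simp] theorem dag_sub (A B : Contracted P F) : dag (A - B) = dag A - dag B := by
  ext i j; simp only [dag_entry, sub_entry]; ring

@[simp] theorem dag_neg (A : Contracted P F) : dag (-A) = -dag A := by
  ext i j; simp only [dag_entry, neg_entry]; ring

@[simp] theorem dag_zero : dag (0 : Contracted P F) = 0 := by
  ext i j; simp only [dag_entry, zero_entry, mul_zero]

@[simp] theorem dag_smul (c : F) (A : Contracted P F) : dag (c • A) = c • dag A := by
  ext i j; simp only [dag_entry, smul_entry]; ring

@[simp] theorem dag_one : dag (1 : Contracted P F) = 1 := by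
  ext i j
  simp only [dag_entry, one_entry]
  by_cases h : i = j
  · subst h; simp [sign_mul_self]
  · have h' : ¬ (-j = -i) := fun e => h (neg_injective e).symm
    rw [if_neg h, if_neg h', mul_zero]

theorem dag_mul (A B : Contracted P F) : dag (A * B) = dag B * dag A := by
  ext i k
  simp only [dag_entry, mul_entry, Finset.mul_sum]
  rw [← Equiv.sum_comp (Equiv.neg (Idx t n))]
  refine Finset.sum_congr rfl fun j _ => ?_
  simp only [Equiv.neg_apply, P.symm]
  have e : Composable (-P.block k) (-P.block j) (-P.block i) ↔
      Composable (P.block i) (P.block j) (P.block k) := by unfold Composable; omega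
  by_cases h : Composable (P.block i) (P.block j) (P.block k)
  · rw [if_pos (e.2 h), if_pos h]
    linear_combination
      -(sign F i * sign F k * A (-k) (-j) * B (-j) (-i)) * sign_mul_self (F := F) j
  · rw [if_neg fun h' => h (e.1 h'), if_neg h, mul_zero]

/-! ### The groups and spaces on which the theory is built -/

/-- The nilpotent ideal `𝒰ᵃ = 𝒰₊ ⊕ 𝒰₋ᵃ` of the algebra `𝔤𝔩ᵃ(M)`: all diagonal blocks are zero. -/
def nil (P : SymPartition t n) (F : Type*) [Field F] : Submodule F (Contracted P F) where
  carrier := {X | ∀ i j, P.block i = P.block j → X i j = 0}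
  add_mem' hX hY i j h := by simp [hX i j h, hY i j h]
  zero_mem' i j _ := rfl
  smul_mem' c X hX i j h := by simp [hX i j h]

theorem nil_mul_left (A : Contracted P F) {X : Contracted P F} (hX : X ∈ nil P F) :
    A * X ∈ nil P F := by
  intro i k h
  rw [mul_entry]
  refine Finset.sum_eq_zero fun j _ => ?_
  split_ifs with hc
  · rw [hX j k (by unfold Composable at hc; omega), mul_zero]
  · rfl

theorem nil_mul_right (A : Contracted P F) {X : Contracted P F} (hX : X ∈ nil P F) :
    X * A ∈ nil P F := by
  intro i k h
  rw [mul_entry]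
  refine Finset.sum_eq_zero fun j _ => ?_
  split_ifs with hc
  · rw [hX i j (by unfold Composable at hc; omega), zero_mul]
  · rfl

/-- The Lie algebra `𝔲ᵃ = {X ∈ 𝒰ᵃ | X† = -X}` of the group `Uᵃ`. -/
def lieU (P : SymPartition t n) (F : Type*) [Field F] : Submodule F (Contracted P F) where
  carrier := {X | X ∈ nil P F ∧ dag X = -X}
  add_mem' hX hY := ⟨add_mem hX.1 hY.1, by rw [dag_add, hX.2, hY.2, neg_add]⟩
  zero_mem' := ⟨zero_mem _, by simp⟩
  smul_mem' c X hX := ⟨Submodule.smul_mem _ c hX.1, by rw [dag_smul, hX.2, smul_neg]⟩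

/-- The group `Uᵃ = {u ∈ 1 + 𝒰ᵃ | u† = u⁻¹}`, a subgroup of the group of invertible elements of the
algebra `𝔤𝔩ᵃ(M)`. -/
def groupU (P : SymPartition t n) (F : Type*) [Field F] : Subgroup (Contracted P F)ˣ where
  carrier := {u | (u : Contracted P F) - 1 ∈ nil P F ∧ dag (u : Contracted P F) = ↑u⁻¹}
  one_mem' := by simp
  mul_mem' {u v} hu hv := by
    refine ⟨?_, ?_⟩
    · have h : ((u * v : (Contracted P F)ˣ) : Contracted P F) - 1 =
          (u - 1 : Contracted P F) * v + (v - 1) := by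
        rw [Units.val_mul]; noncomm_ring
      rw [h]
      exact add_mem (nil_mul_right _ hu.1) hv.1
    · rw [Units.val_mul, dag_mul, hu.2, hv.2, mul_inv_rev, Units.val_mul]
  inv_mem' {u} hu := by
    refine ⟨?_, ?_⟩
    · have h : ((u⁻¹ : (Contracted P F)ˣ) : Contracted P F) - 1 =
          -((u⁻¹ : (Contracted P F)ˣ) : Contracted P F) * (u - 1 : Contracted P F) := by
        rw [mul_sub, neg_mul, Units.inv_mul]; simp; abel
      rw [h]
      exact nil_mul_left _ hu.1
    · rw [inv_inv, ← hu.2, dag_dag]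

/-- The map `X ↦ A X A†` on `𝔲ᵃ`. -/
def conj (A : Contracted P F) : lieU P F →ₗ[F] lieU P F where
  toFun X := ⟨A * X * dag A, nil_mul_right _ (nil_mul_left _ X.2.1), by
    rw [dag_mul, dag_mul, dag_dag, X.2.2, neg_mul, mul_neg, mul_assoc]⟩
  map_add' X Y := Subtype.ext (by simp [mul_add, add_mul])
  map_smul' c X := Subtype.ext (by simp)

/-- The orbit of `X ∈ 𝔲ᵃ` under the action `g · X = g X g†` of the contraction of `GL(M)`, i.e. of
the group of all invertible elements of the algebra `𝔤𝔩ᵃ(M)`. -/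
def orbit (X : lieU P F) : Set (lieU P F) :=
  {Y | ∃ g : (Contracted P F)ˣ, Y = conj (g : Contracted P F) X}

/-- The orbit of a linear form `l` on `𝔲ᵃ` under the action `(g · l)(X) = l(g† X g)` of the
contraction of `GL(M)`; note that `conj (dag g)` is the map `X ↦ g† X g`. -/
def dualOrbit (l : Module.Dual F (lieU P F)) : Set (Module.Dual F (lieU P F)) :=
  {m | ∃ g : (Contracted P F)ˣ, m = l ∘ₗ conj (dag (g : Contracted P F))}

/-- The Cayley map `f(u) = 2 (u - 1) (u + 1)⁻¹` from `Uᵃ` to `𝔲ᵃ`. In characteristic `≠ 2` the element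
`u + 1 = 2 + (u - 1)` is invertible, as `u - 1` is nilpotent. -/
def cayley (u : groupU P F) : lieU P F :=
  ⟨2 * ((u : (Contracted P F)ˣ) - 1 : Contracted P F) *
      Ring.inverse ((u : (Contracted P F)ˣ) + 1 : Contracted P F), by
    obtain ⟨u, hu1, hu2⟩ := u
    refine ⟨nil_mul_right _ (nil_mul_left _ hu1), ?_⟩
    by_cases h : IsUnit ((u : Contracted P F) + 1)
    · obtain ⟨w, hw⟩ := h
      simp only [← hw, Ring.inverse_unit]
      have h2 : dag (2 : Contracted P F) = 2 := by
        rw [← one_add_one_eq_two, dag_add, dag_one]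
      have hd : dag (w : Contracted P F) = (u⁻¹ : (Contracted P F)ˣ) * w := by
        rw [hw, dag_add, dag_one, hu2, mul_add, Units.inv_mul, mul_one, add_comm]
      have hdi : dag ((w⁻¹ : (Contracted P F)ˣ) : Contracted P F) =
          (w⁻¹ : (Contracted P F)ˣ) * (u : Contracted P F) := by
        have e : dag ((w⁻¹ : (Contracted P F)ˣ) : Contracted P F) *
            dag (w : Contracted P F) = 1 := by
          rw [← dag_mul, Units.mul_inv, dag_one]
        have e2 : dag (w : Contracted P F) *
            ((w⁻¹ : (Contracted P F)ˣ) * (u : Contracted P F)) = 1 := by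
          rw [hd, mul_assoc, ← mul_assoc (w : Contracted P F), Units.mul_inv, one_mul,
            Units.inv_mul]
        exact left_inv_eq_right_inv e e2
      have hc : ((u : Contracted P F) - 1) * (w⁻¹ : (Contracted P F)ˣ) =
          (w⁻¹ : (Contracted P F)ˣ) * ((u : Contracted P F) - 1) := by
        have : Commute ((u : Contracted P F) - 1) (w : Contracted P F) := by
          rw [hw, commute_iff_eq]; noncomm_ring
        exact this.units_inv_right
      rw [dag_mul, dag_mul, h2, dag_sub, dag_one, hu2, hdi, mul_assoc 2, hc, two_mul, mul_two]
      have h3 : (u : Contracted P F) * ((u⁻¹ : (Contracted P F)ˣ) - 1 : Contracted P F) =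
          -((u : Contracted P F) - 1) := by
        rw [mul_sub, Units.mul_inv, mul_one]; abel
      simp only [mul_add, mul_assoc, h3, mul_neg, neg_add]
    · simp [Ring.inverse_non_unit _ h]⟩

/-! ### Roots, rook placements, basic pairs -/

/-- The pairs attached to positive roots: `(i, j)` for `ε_i - ε_j`, `(i, -j)` for `ε_i + ε_j`
(`i > j > 0`), `(i, 0)` for `ε_i` (series `B`), and `(i, -i)` for `2 ε_i` (series `C`). -/
def IsPosRoot (i j : Idx t n) : Prop :=
  |(j : ℤ)| < i ∨ (t = Series.C ∧ 0 < (i : ℤ) ∧ j = -i)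

/-- The pair attached to a negative root is the transpose of the pair of the opposite root. -/
def IsRoot (i j : Idx t n) : Prop := IsPosRoot i j ∨ IsPosRoot j i

/-- The set `Δ(𝔲ᵃ)` of (pairs attached to) roots whose root vectors lie in `𝔲ᵃ`. -/
abbrev Root (P : SymPartition t n) : Type :=
  {γ : Idx t n × Idx t n // IsRoot γ.1 γ.2 ∧ P.block γ.1 ≠ P.block γ.2}

/-- `γ' = (-j, -i)` for `γ = (i, j)`. -/
def prime (γ : Idx t n × Idx t n) : Idx t n × Idx t n := (-γ.2, -γ.1)

/-- The matrix unit `E_γ` (denoted `F_γ` if `γ` is negative). -/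
def unitMatrix (P : SymPartition t n) (F : Type*) [Field F] (γ : Idx t n × Idx t n) :
    Contracted P F :=
  fun i j => if (i, j) = γ then 1 else 0

theorem dag_unitMatrix (γ : Idx t n × Idx t n) :
    dag (unitMatrix P F γ) = (sign F γ.1 * sign F γ.2) • unitMatrix P F (prime γ) := by
  obtain ⟨a, b⟩ := γ
  ext i j
  simp only [dag_entry, smul_entry, unitMatrix, prime, Prod.mk.injEq]
  by_cases h : i = -b ∧ j = -a
  · obtain ⟨rfl, rfl⟩ := h
    simp [sign_neg_mul_sign_neg]
  · have h' : ¬ (-j = a ∧ -i = b) := fun h' => h ⟨by rw [← h'.2, neg_neg], by rw [← h'.1, neg_neg]⟩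
    rw [if_neg h, if_neg h', mul_zero, mul_zero]

theorem dag_mem_nil {X : Contracted P F} (hX : X ∈ nil P F) : dag X ∈ nil P F := by
  intro i j h
  rw [dag_entry, hX _ _ (by rw [P.symm, P.symm, h]), mul_zero]

theorem unitMatrix_mem_nil (γ : Root P) : unitMatrix P F γ.1 ∈ nil P F := by
  intro i j h
  refine if_neg fun e => γ.2.2 ?_
  rw [← e]
  exact h

theorem dag_unitMatrix_of_prime_eq (γ : Root P) (h : prime γ.1 = γ.1) :
    dag (unitMatrix P F γ.1) = -unitMatrix P F γ.1 := by
  obtain ⟨⟨i, j⟩, hr, hb⟩ := γ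
  have hj : j = -i := (congrArg Prod.snd h).symm
  subst hj
  have ht : t = Series.C := by
    rcases hr with (hr | hr) | (hr | hr)
    · simp only [coe_neg, abs_neg] at hr
      exact absurd hr (not_lt.2 (le_abs_self _))
    · exact hr.1
    · simp only [coe_neg] at hr
      exact absurd hr (not_lt.2 (neg_le_abs _))
    · exact hr.1
  rw [dag_unitMatrix, h, sign_mul_sign_neg, if_pos ht, neg_one_smul]

open Classical in
/-- The root vector `E_γ + η(γ) E_{γ'}` in `𝔲ᵃ`: it is `E_γ` if `γ = γ'`, and otherwise
`E_γ - (E_γ)†`, where `(E_γ)† = ± E_{γ'}`. -/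
def rootVector (F : Type*) [Field F] (γ : Root P) : lieU P F :=
  ⟨if prime γ.1 = γ.1 then unitMatrix P F γ.1 else unitMatrix P F γ.1 - dag (unitMatrix P F γ.1), by
    have h0 := unitMatrix_mem_nil (F := F) γ
    split_ifs with h
    · exact ⟨h0, dag_unitMatrix_of_prime_eq γ h⟩
    · exact ⟨sub_mem h0 (dag_mem_nil h0), by rw [dag_sub, dag_dag, neg_sub]⟩⟩

/-- The member of the basis dual to the basis of root vectors attached to `γ` (see
`rootCoord_rootVector` and `sum_rootCoord_smul`): the entry at `γ`. -/
def rootCoord (F : Type*) [Field F] (γ : Root P) : Module.Dual F (lieU P F) where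
  toFun X := (X : Contracted P F) γ.1.1 γ.1.2
  map_add' _ _ := rfl
  map_smul' _ _ := rfl

/-- If both `γ` and `γ'` are attached to roots, then `γ = γ'`. -/
theorem prime_eq_of_root (γ δ : Root P) (h : prime γ.1 = δ.1) : γ = δ := by
  obtain ⟨⟨i, j⟩, hr, hb⟩ := γ
  obtain ⟨⟨k, l⟩, hr', hb'⟩ := δ
  have hk : k = -j := (congrArg Prod.fst h).symm
  have hl : l = -i := (congrArg Prod.snd h).symm
  subst hk; subst hl
  by_cases hij : j = -i
  · subst hij; simp
  · exfalso
    have h1 : ¬ i = -j := fun e => hij (by rw [e, neg_neg])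
    have h2 : ¬ -i = j := fun e => hij e.symm
    have h3 : ¬ -j = i := fun e => h1 e.symm
    simp only [IsRoot, IsPosRoot, neg_neg, coe_neg, abs_neg, abs_lt, hij, h1, h2, h3, and_false,
      or_false] at hr hr'
    omega

theorem rootCoord_rootVector (γ δ : Root P) :
    rootCoord F γ (rootVector F δ) = if γ = δ then 1 else 0 := by
  have hu : unitMatrix P F δ.1 γ.1.1 γ.1.2 = if γ = δ then 1 else 0 :=
    if_congr Subtype.ext_iff.symm rfl rfl
  change (rootVector F δ : Contracted P F) γ.1.1 γ.1.2 = _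
  unfold rootVector
  by_cases h : prime δ.1 = δ.1
  · simp only [if_pos h, hu]
  · have hz : unitMatrix P F (prime δ.1) γ.1.1 γ.1.2 = 0 := by
      refine if_neg fun e => h ?_
      have e' : prime δ.1 = γ.1 := e.symm
      rw [e', prime_eq_of_root δ γ e']
    simp only [if_neg h, sub_entry, hu, dag_unitMatrix, smul_entry, hz, mul_zero, sub_zero]

/-- Off the diagonal blocks, one of `γ` and `γ'` is attached to a root, unless the series is `B` or
`D` and `γ = γ'`. -/
theorem root_or_prime (i j : Idx t n) (hb : P.block i ≠ P.block j) :
    IsRoot i j ∨ IsRoot (-j) (-i) ∨ (t ≠ Series.C ∧ j = -i) := by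
  have hne : (i : ℤ) ≠ j := fun e => hb (congrArg P.block (Subtype.ext e))
  by_cases hij : j = -i
  · by_cases ht : t = Series.C
    · left
      have hj : (j : ℤ) = -i := by rw [hij, coe_neg]
      rcases lt_trichotomy (i : ℤ) 0 with h | h | h
      · exact Or.inr (Or.inr ⟨ht, by omega, by rw [hij, neg_neg]⟩)
      · omega
      · exact Or.inl (Or.inr ⟨ht, h, hij⟩)
    · exact Or.inr (Or.inr ⟨ht, hij⟩)
  · have hij' : (j : ℤ) ≠ -i := fun e => hij (Subtype.ext e)
    simp only [IsRoot, IsPosRoot, coe_neg, abs_neg, abs_lt]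
    omega

/-- In characteristic `≠ 2` the root vectors span `𝔲ᵃ`. -/
theorem sum_rootCoord_smul (h2 : (2 : F) ≠ 0) (X : lieU P F) [Fintype (Root P)] :
    ∑ γ : Root P, rootCoord F γ X • rootVector F γ = X := by
  set Y := ∑ γ : Root P, rootCoord F γ X • rootVector F γ with hY
  have hcoord : ∀ δ : Root P, rootCoord F δ (Y - X) = 0 := by
    intro δ
    rw [map_sub, hY, map_sum]
    simp only [map_smul, rootCoord_rootVector, smul_eq_mul, mul_ite, mul_one, mul_zero]
    rw [Finset.sum_ite_eq Finset.univ δ, if_pos (Finset.mem_univ _), sub_self]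
  rw [← sub_eq_zero]
  generalize Y - X = Z at hcoord
  obtain ⟨Z, hn, hd⟩ := Z
  have hanti : ∀ i j, sign F i * sign F j * Z (-j) (-i) = -Z i j := fun i j =>
    congrFun (congrFun hd i) j
  have hroot : ∀ i j, IsRoot i j → P.block i ≠ P.block j → Z i j = 0 := fun i j h hb =>
    hcoord ⟨(i, j), h, hb⟩
  refine Subtype.ext (Contracted.ext fun i j => ?_)
  change Z i j = 0
  by_cases hb : P.block i = P.block j
  · exact hn i j hb
  rcases root_or_prime (P := P) i j hb with h | h | ⟨ht, hj⟩
  · exact hroot i j h hb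
  · have := hanti i j
    rw [hroot _ _ h (by rw [P.symm, P.symm]; omega), mul_zero] at this
    exact neg_eq_zero.1 this.symm
  · subst hj
    have := hanti i (-i)
    rw [sign_mul_sign_neg, if_neg ht, one_mul, neg_neg] at this
    have h3 : (2 : F) * Z i (-i) = 0 := by linear_combination this
    exact (mul_eq_zero.1 h3).resolve_left h2

/-- The matrix positions `D ∪ D'` of a set `D` of roots. -/
def positions (D : Finset (Root P)) : Set (Idx t n × Idx t n) :=
  {p | ∃ γ ∈ D, p = γ.1 ∨ p = prime γ.1}

/-- `D` is a rook placement: `D ∪ D'` has at most one pair in any row and in any column. -/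
def IsRookPlacement (D : Finset (Root P)) : Prop :=
  ∀ p ∈ positions D, ∀ q ∈ positions D, (p.1 = q.1 ∨ p.2 = q.2) → p = q

/-- `γ` lies on the antidiagonal. -/
def IsAntidiagonal (γ : Root P) : Prop := γ.1.2 = -γ.1.1

/-- The condition on a pair `(D, φ)` to be basic, with respect to a fixed nonsquare `δ`. In the
cases `B` and `D` all values of `φ` are `1`. In the case `C` the values are `1` or `δ`, the value
`δ` is taken only on the antidiagonal, and for every `k` the set `D ∩ (I_k × I_{-k})` is contained
in the antidiagonal and has at most one root with value `δ`. -/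
def IsBasic (δ : Fˣ) (D : Finset (Root P)) (φ : D → Fˣ) : Prop :=
  (t ≠ Series.C → ∀ γ, φ γ = 1) ∧
  (t = Series.C →
    (∀ γ, φ γ = 1 ∨ φ γ = δ) ∧
    (∀ γ, φ γ = δ → IsAntidiagonal γ.1) ∧
    ∀ k : ℤ,
      (∀ γ : D, P.block γ.1.1.1 = k → P.block γ.1.1.2 = -k → IsAntidiagonal γ.1) ∧
      (∀ γ γ' : D, P.block γ.1.1.1 = k → P.block γ.1.1.2 = -k →
        P.block γ'.1.1.1 = k → P.block γ'.1.1.2 = -k → φ γ = δ → φ γ' = δ → γ = γ'))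

/-- The basic pairs `(D, φ)`: `D` is a rook placement in `Δ(𝔲ᵃ)` and `φ : D → Fˣ`. -/
structure BasicPair (P : SymPartition t n) (δ : Fˣ) where
  D : Finset (Root P)
  φ : D → Fˣ
  rook : IsRookPlacement D
  basic : IsBasic δ D φ

variable {δ : Fˣ}

/-- The element of `𝔲ᵃ` attached to `(D, φ)`: the sum of `φ(γ)` times the root vector of `γ`. -/
def BasicPair.vector (b : BasicPair P δ) : lieU P F :=
  ∑ γ : b.D, (b.φ γ : F) • rootVector F γ.1

/-- The linear form `Λ_{D,φ}` on `𝔲ᵃ`. -/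
def BasicPair.form (b : BasicPair P δ) : Module.Dual F (lieU P F) :=
  ∑ γ : b.D, (b.φ γ : F) • rootCoord F γ.1

/-- The function `σ_{D,φ}(u) = ∑ ε^{μ(f(u))}`, the sum over the orbit of `Λ_{D,φ}` (a finite set
when `F` is finite). -/
def BasicPair.sigma (ε : AddChar F ℂ) (b : BasicPair P δ) : groupU P F → ℂ :=
  fun u => ∑ᶠ μ ∈ dualOrbit b.form, ε (μ (cayley u))

/-- The class `K_{D,φ}`: the preimage of the orbit of the vector of `(D, φ)` under the Cayley map. -/
def BasicPair.superclass (b : BasicPair P δ) : Set (groupU P F) :=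
  cayley ⁻¹' orbit b.vector

end Algebra

end

end ParabolicContraction

namespace ParabolicContraction

noncomputable section

/-! ### Characters from systems of functions on a finite group -/

/-! The Cayley map `f` is a bijection that is additive up to the action: `f(uv) = g · (f(u) + f(v))`
for some invertible `g` depending on `u` and `v` (`cayley_mul`). When `ε^{μ(f(·))}` is summed over a
stable set of forms `μ`, the element `g` disappears, so `σ(uv) = ∑ ε^{μ(f(u))} ε^{μ(f(v))}`
(`orbitSum_mul`). The functions `ε^{μ∘f}` are orthogonal, hence `σ` is the trace of right
translations on their span, and sums over disjoint stable sets have no common constituent. Stability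
also makes `σ` constant on the preimages of orbits.

The two counts agree because `𝔲ᵃ` is self-dual. If the blocks are placed on a circle, the contracted
product keeps exactly the compositions that stay within one turn (`composable_iff`). This condition
is cyclically symmetric on off-diagonal blocks, so the trace form is invariant there
(`tracePairing_mul_left`), and `toDual` is an equivariant bijection carrying orbits in `𝔲ᵃ` to
orbits in its dual.

It remains to find a basic pair in every orbit of either kind. Uniqueness is not needed, since only
distinct functions and distinct classes are counted. Existence is Gaussian elimination, performed
simultaneously at `(i, j)` and `(-j, -i)`. At a pivot of minimal cyclic distance all required row
operations exist in the contracted algebra (`composable_of_cycDist_le`), and a root vector splits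
off (`exists_conj_monomial`). Diagonal matrices then make the coefficients `1`, or `1` and `δ` on
the antidiagonal, and two values `δ` in one block are removed by a rotation because `δ⁻¹` is a sum
of two squares (`exists_basicPair`). -/

section Characters

variable {G : Type*} [Group G]

/-- If `σ (u v) = ∑ e i u * e i v` for a system of functions `e i` with orthogonality relations,
then `σ` is the character of the span of the system, on which `G` acts by right translations. -/
theorem isCharacter_of_sum_mul {ι : Type*} [Fintype ι] [Nonempty ι] [Fintype G]
    (e : ι → G → ℂ) (σ : G → ℂ) (hmul : ∀ u v, ∑ i, e i u * e i v = σ (u * v))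
    (horth : ∀ i j, i ≠ j → ∑ u, e i u⁻¹ * e j u = 0)
    (hnorm : ∀ i, ∑ u, e i u⁻¹ * e i u = Fintype.card G) : IsCharacter σ := by
  classical
  have hc : (Fintype.card G : ℂ) ≠ 0 := Nat.cast_ne_zero.2 Fintype.card_ne_zero
  have horth' : ∀ i j, ∑ u, e i u⁻¹ * e j u = if i = j then (Fintype.card G : ℂ) else 0 := by
    intro i j
    split_ifs with h
    · subst h; exact hnorm i
    · exact horth i j h
  -- Reproducing property: convolution with `σ` acts on the span of the `e j` as the scalar `|G|`.
  have hrepr : ∀ (x : G) (j : ι), ∑ v, σ (x * v⁻¹) * e j v = Fintype.card G * e j x := by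
    intro x j
    simp only [← hmul, Finset.sum_mul]
    rw [Finset.sum_comm]
    simp only [mul_assoc, ← Finset.mul_sum, horth', mul_ite, mul_zero, Finset.sum_ite_eq',
      Finset.mem_univ, if_true]
    ring
  -- The matrix of right translation by `w`: its entries are the coefficients of the translate of `e
  -- j`, read off with the orthogonality relations.
  let M : G → Matrix ι ι ℂ := fun w i j => (Fintype.card G : ℂ)⁻¹ * ∑ v, e i v⁻¹ * e j (v * w)
  have hM1 : M 1 = 1 := by
    ext i j
    simp only [M, mul_one, horth', Matrix.one_apply]
    split_ifs <;> simp [hc]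
  have hMmul : ∀ w w', M (w * w') = M w * M w' := by
    intro w w'
    ext i j
    have key : ∀ v, ∑ k, e k (v * w) * ∑ v', e k v'⁻¹ * e j (v' * w') =
        Fintype.card G * e j (v * w * w') := by
      intro v
      rw [← hrepr (v * w * w') j]
      simp only [Finset.mul_sum]
      rw [Finset.sum_comm, ← Equiv.sum_comp (Equiv.mulRight w'⁻¹)]
      refine Finset.sum_congr rfl fun x _ => ?_
      simp only [Equiv.coe_mulRight, mul_inv_rev, inv_inv, inv_mul_cancel_right, ← mul_assoc,
        ← Finset.sum_mul, hmul]
    rw [Matrix.mul_apply]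
    have : ∀ k, M w i k * M w' k j = ∑ v, (Fintype.card G : ℂ)⁻¹ *
        (Fintype.card G : ℂ)⁻¹ * e i v⁻¹ * (e k (v * w) * ∑ v', e k v'⁻¹ * e j (v' * w')) := by
      intro k
      simp only [M]
      rw [mul_mul_mul_comm, Finset.sum_mul, Finset.mul_sum]
      exact Finset.sum_congr rfl fun v _ => by ring
    rw [Finset.sum_congr rfl fun k _ => this k, Finset.sum_comm]
    simp only [← Finset.mul_sum, key, M]
    simp only [Finset.mul_sum]
    refine Finset.sum_congr rfl fun v _ => ?_
    rw [mul_assoc v]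
    field_simp
  have htr : ∀ w, (M w).trace = σ w := by
    intro w
    simp only [M, Matrix.trace, Matrix.diag, ← Finset.mul_sum]
    rw [Finset.sum_comm]
    simp only [hmul, inv_mul_cancel_left]
    simp [hc]
  let E := Fintype.equivFin ι
  let N : G → Matrix (Fin (Fintype.card ι)) (Fin (Fintype.card ι)) ℂ := fun w =>
    Matrix.reindexAlgEquiv ℂ ℂ E (M w)
  refine ⟨Fintype.card ι, ⟨⟨fun w => Matrix.toLin' (N w), ?_⟩, ?_⟩, Fintype.card_pos, fun g => ?_⟩
  · simp only [N, hM1, map_one, Matrix.toLin'_one]; rfl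
  · intro w w'
    simp only [N, hMmul, map_mul, Matrix.toLin'_mul]; rfl
  · change σ g = LinearMap.trace ℂ _ (Matrix.toLin' (N g))
    rw [Matrix.trace_toLin'_eq, ← htr]
    simp only [N, Matrix.trace, Matrix.diag, Matrix.coe_reindexAlgEquiv, Matrix.reindex_apply,
      Matrix.submatrix_apply]
    exact (Equiv.sum_comp E.symm fun i => M g i i).symm

/-- The scalar product of two characters is the dimension of the space of intertwining maps. -/
theorem charDisjoint_of_sum_eq_zero [Fintype G] {χ ψ : G → ℂ} (h : ∑ g, ψ g * χ g⁻¹ = 0) :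
    CharDisjoint χ ψ := by
  intro d e ρ τ hχ hψ f hf
  have hc : (Nat.card G : ℂ) ≠ 0 := Nat.cast_ne_zero.2 Nat.card_pos.ne'
  let _ : Invertible (Nat.card G : ℂ) := invertibleOfNonzero hc
  have h1 := Representation.card_inv_mul_sum_char_mul_char_eq_finrank ρ τ
  simp only [← hχ, ← hψ, h, mul_zero] at h1
  have h2 : Module.finrank ℂ (Representation.IntertwiningMap ρ τ) = 0 := by exact_mod_cast h1.symm
  have e1 := Representation.invariantsEquivIntertwiningMap ρ τ
  have : Module.Finite ℂ (Representation.IntertwiningMap ρ τ) := Module.Finite.equiv e1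
  have h3 := Module.finrank_zero_iff.1 h2
  let F : Representation.IntertwiningMap ρ τ := f.intertwiningMap_of_isIntertwiningMap ρ τ hf
  have hF : F = 0 := Subsingleton.elim _ _
  exact congrArg (fun x : Representation.IntertwiningMap ρ τ => x.toLinearMap) hF

end Characters

variable {t : Series} {n : ℕ} {F : Type*} [Field F] {P : SymPartition t n}

/-! ### The filtration by cyclic distance -/

/-- The cyclic distance from block `a` down to block `b`, for a cycle of length `N`. -/
def cycDist (N a b : ℤ) : ℤ := if b ≤ a then a - b else a - b + N

/-- With blocks on a circle, the right side says that the paths from `a` to `b` and from `b` to `c`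
together wrap around as often as the path from `a` to `c`. In this form the contracted algebra is
graded by cyclic distance, which drives nilpotency and the choice of pivots. -/
theorem composable_iff {N : ℤ} (hN : N ≠ 0) (a b c : ℤ) :
    Composable a b c ↔ cycDist N a b + cycDist N b c = cycDist N a c := by
  unfold Composable cycDist
  split_ifs <;> omega

theorem exists_block_bound (P : SymPartition t n) :
    ∃ N : ℤ, 0 < N ∧ ∀ i j, P.block i - P.block j < N := by
  refine ⟨1 + 2 * ∑ i, |P.block i|, by positivity, fun i j => ?_⟩
  have h : ∀ i, |P.block i| ≤ ∑ i, |P.block i| := fun i =>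
    Finset.single_le_sum (f := fun i => |P.block i|) (fun _ _ => abs_nonneg _) (Finset.mem_univ i)
  have h1 := le_abs_self (P.block i)
  have h2 := neg_abs_le (P.block j)
  have h3 := h i
  have h4 := h j
  omega

/-- All nonzero entries of `X` are at positions of cyclic distance at least `m`. -/
def SupportedFrom (N m : ℤ) (X : Contracted P F) : Prop :=
  ∀ i j, X i j ≠ 0 → m ≤ cycDist N (P.block i) (P.block j)

theorem supportedFrom_zero {N : ℤ} (hb : ∀ i j, P.block i - P.block j < N) (X : Contracted P F) :
    SupportedFrom N 0 X := by
  intro i j _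
  have := hb j i
  unfold cycDist
  split_ifs <;> omega

theorem supportedFrom_one {N : ℤ} (hb : ∀ i j, P.block i - P.block j < N) {X : Contracted P F}
    (hX : X ∈ nil P F) : SupportedFrom N 1 X := by
  intro i j h
  have h1 := hb j i
  have h2 : P.block i ≠ P.block j := fun e => h (hX i j e)
  unfold cycDist
  split_ifs <;> omega

theorem SupportedFrom.mul {N m m' : ℤ} (hN : 0 < N) {X Y : Contracted P F}
    (hX : SupportedFrom N m X) (hY : SupportedFrom N m' Y) : SupportedFrom N (m + m') (X * Y) := by
  intro i k h
  rw [mul_entry] at h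
  obtain ⟨j, -, hj⟩ := Finset.exists_ne_zero_of_sum_ne_zero h
  split_ifs at hj with hc
  · rw [composable_iff hN.ne'] at hc
    have h1 := hX i j (left_ne_zero_of_mul hj)
    have h2 := hY j k (right_ne_zero_of_mul hj)
    omega
  · exact absurd rfl hj

/-- Each factor from the ideal raises the cyclic distance by at least `1`, while all distances are
below `N`. -/
theorem isNilpotent_of_mem_nil {X : Contracted P F} (hX : X ∈ nil P F) : IsNilpotent X := by
  obtain ⟨N, hN, hb⟩ := exists_block_bound P
  have hpow : ∀ m : ℕ, SupportedFrom N m (X ^ m) := by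
    intro m
    induction m with
    | zero => exact supportedFrom_zero hb _
    | succ m ih =>
      rw [pow_succ, Nat.cast_succ]
      exact ih.mul hN (supportedFrom_one hb hX)
  refine ⟨N.toNat, Contracted.ext fun i j => ?_⟩
  by_contra h
  have h1 := hpow N.toNat i j h
  have h2 := hb i j
  rw [Int.toNat_of_nonneg hN.le] at h1
  unfold cycDist at h1
  split_ifs at h1 <;> omega

/-! ### The Cayley map -/

theorem isUnit_add_of_mem_nil {c : F} (hc : c ≠ 0) {X : Contracted P F} (hX : X ∈ nil P F) :
    IsUnit (algebraMap F (Contracted P F) c + X) :=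
  (isNilpotent_of_mem_nil hX).isUnit_add_left_of_commute ((IsUnit.mk0 c hc).map _)
    (Algebra.commutes c X).symm

theorem algebraMap_two : algebraMap F (Contracted P F) 2 = 2 := map_ofNat _ 2

theorem isUnit_two_sub (h2 : (2 : F) ≠ 0) {X : Contracted P F} (hX : X ∈ nil P F) :
    IsUnit (2 - X) := by
  have := isUnit_add_of_mem_nil h2 (neg_mem hX)
  rwa [algebraMap_two, ← sub_eq_add_neg] at this

theorem isUnit_two_add (h2 : (2 : F) ≠ 0) {X : Contracted P F} (hX : X ∈ nil P F) :
    IsUnit (2 + X) := by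
  have := isUnit_add_of_mem_nil h2 hX
  rwa [algebraMap_two] at this

theorem isUnit_add_one (h2 : (2 : F) ≠ 0) (u : groupU P F) :
    IsUnit (((u : (Contracted P F)ˣ) : Contracted P F) + 1) := by
  have h := isUnit_two_add h2 u.2.1
  rwa [← one_add_one_eq_two, add_assoc, add_sub_cancel, add_comm] at h

theorem dag_two : dag (2 : Contracted P F) = 2 := by
  rw [← one_add_one_eq_two, dag_add, dag_one]

theorem cayley_coe (u : groupU P F) : (cayley u : Contracted P F) =
    2 * ((u : (Contracted P F)ˣ) - 1 : Contracted P F) *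
      Ring.inverse ((u : (Contracted P F)ˣ) + 1 : Contracted P F) := rfl

theorem cayley_mul_add_one (h2 : (2 : F) ≠ 0) (u : groupU P F) :
    (cayley u : Contracted P F) * (((u : (Contracted P F)ˣ) : Contracted P F) + 1) =
      2 * (((u : (Contracted P F)ˣ) : Contracted P F) - 1) := by
  rw [cayley_coe]
  exact Ring.inverse_mul_cancel_right _ _ (isUnit_add_one h2 u)

theorem eq_cayley_of_mul (h2 : (2 : F) ≠ 0) (u : groupU P F) {X : Contracted P F}
    (hX : X * (((u : (Contracted P F)ˣ) : Contracted P F) + 1) =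
      2 * (((u : (Contracted P F)ˣ) : Contracted P F) - 1)) : (cayley u : Contracted P F) = X :=
  (isUnit_add_one h2 u).mul_right_cancel ((cayley_mul_add_one h2 u).trans hX.symm)

theorem commute_of_mul_add_one {R : Type*} [Ring R] {W x : R} (hx : IsUnit (x + 1))
    (h : W * (x + 1) = 2 * (x - 1)) : Commute W x := by
  refine hx.mul_right_cancel ?_
  have e1 : W * x * (x + 1) = W * (x + 1) * x := by noncomm_ring
  have e2 : x * W * (x + 1) = x * (W * (x + 1)) := by noncomm_ring
  rw [e1, e2, h]
  noncomm_ring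

theorem two_sub_mul_of_mul_add_one {R : Type*} [Ring R] {W x : R}
    (h : W * (x + 1) = 2 * (x - 1)) : (2 - W) * x = 2 + W := by
  have e : (2 - W) * x - (2 + W) = 2 * (x - 1) - W * (x + 1) := by
    rw [← one_add_one_eq_two]; noncomm_ring
  rw [← sub_eq_zero, e, h, sub_self]

theorem mul_two_sub_of_mul_add_one {R : Type*} [Ring R] {W x : R} (hx : IsUnit (x + 1))
    (h : W * (x + 1) = 2 * (x - 1)) : x * (2 - W) = 2 + W := by
  rw [← two_sub_mul_of_mul_add_one h, mul_sub, sub_mul, (commute_of_mul_add_one hx h).eq,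
    mul_two, two_mul]

theorem mul_add_one_of_mul_two_sub {R : Type*} [Ring R] {W x : R} (h : (2 - W) * x = 2 + W) :
    W * (x + 1) = 2 * (x - 1) := by
  have e : 2 * (x - 1) - W * (x + 1) = (2 - W) * x - (2 + W) := by
    rw [← one_add_one_eq_two]; noncomm_ring
  rw [eq_comm, ← sub_eq_zero, e, h, sub_self]

theorem cayley_injective (h2 : (2 : F) ≠ 0) :
    Function.Injective (cayley : groupU P F → lieU P F) := by
  intro u v h
  have hu := two_sub_mul_of_mul_add_one (cayley_mul_add_one h2 u)
  rw [h, ← two_sub_mul_of_mul_add_one (cayley_mul_add_one h2 v)] at hu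
  exact Subtype.ext (Units.ext ((isUnit_two_sub h2 (cayley v).2.1).mul_left_cancel hu))

/-- The antiautomorphism on invertible elements. -/
def dagUnit (g : (Contracted P F)ˣ) : (Contracted P F)ˣ where
  val := dag (g : Contracted P F)
  inv := dag ((g⁻¹ : (Contracted P F)ˣ) : Contracted P F)
  val_inv := by rw [← dag_mul, Units.inv_mul, dag_one]
  inv_val := by rw [← dag_mul, Units.mul_inv, dag_one]

@[simp] theorem coe_dagUnit (g : (Contracted P F)ˣ) :
    (dagUnit g : Contracted P F) = dag (g : Contracted P F) := rfl

theorem coe_inv_dagUnit (g : (Contracted P F)ˣ) :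
    (((dagUnit g)⁻¹ : (Contracted P F)ˣ) : Contracted P F) =
      dag ((g⁻¹ : (Contracted P F)ˣ) : Contracted P F) := rfl

/-- The preimage of `X` is `(2 - X)⁻¹ (2 + X)`. The antiautomorphism exchanges the two commuting
factors `2 - X` and `2 + X`, so this element lies in the group. -/
theorem cayley_surjective (h2 : (2 : F) ≠ 0) :
    Function.Surjective (cayley : groupU P F → lieU P F) := by
  rintro ⟨X, hX, hd⟩
  obtain ⟨p, hp⟩ := isUnit_two_sub h2 hX
  have hq : (dagUnit p : Contracted P F) = 2 + X := by
    rw [coe_dagUnit, hp, dag_sub, dag_two, hd, sub_neg_eq_add]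
  have hpq : dagUnit p * p = p * dagUnit p := by
    refine Units.ext ?_
    rw [Units.val_mul, Units.val_mul, hp, hq]
    noncomm_ring
  refine ⟨⟨p⁻¹ * dagUnit p, ?_, ?_⟩, Subtype.ext (eq_cayley_of_mul h2 _ ?_)⟩
  · have e : ((p⁻¹ * dagUnit p : (Contracted P F)ˣ) : Contracted P F) - 1 =
        ((p⁻¹ : (Contracted P F)ˣ) : Contracted P F) * (X + X) := by
      rw [Units.val_mul, hq]
      calc _ = ((p⁻¹ : (Contracted P F)ˣ) : Contracted P F) * (2 + X) -
            ((p⁻¹ : (Contracted P F)ˣ) : Contracted P F) * p := by rw [Units.inv_mul]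
        _ = _ := by rw [hp, ← mul_sub]; congr 1; abel
    rw [e]
    exact nil_mul_left _ (add_mem hX hX)
  · rw [Units.val_mul, dag_mul, mul_inv_rev, inv_inv, coe_dagUnit, dag_dag, ← coe_inv_dagUnit,
      ← Units.val_mul]
    change _ = (((dagUnit p)⁻¹ * p : (Contracted P F)ˣ) : Contracted P F)
    rw [Units.val_inj, mul_inv_eq_iff_eq_mul, mul_assoc, ← hpq, inv_mul_cancel_left]
  · refine mul_add_one_of_mul_two_sub ?_
    change (2 - X) * ((p⁻¹ * dagUnit p : (Contracted P F)ˣ) : Contracted P F) = 2 + X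
    rw [← hp, ← hq, ← Units.val_mul, mul_inv_cancel_left]

theorem cayley_one (h2 : (2 : F) ≠ 0) : cayley (1 : groupU P F) = 0 :=
  Subtype.ext (eq_cayley_of_mul h2 _ (by simp))

theorem cayley_inv (h2 : (2 : F) ≠ 0) (u : groupU P F) : cayley u⁻¹ = -cayley u := by
  refine Subtype.ext (eq_cayley_of_mul h2 _ ?_)
  have h := cayley_mul_add_one h2 u
  have h' := congrArg (· * (((u⁻¹ : groupU P F) : (Contracted P F)ˣ) : Contracted P F)) h
  have e : ((u : (Contracted P F)ˣ) : Contracted P F) *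
      (((u⁻¹ : groupU P F) : (Contracted P F)ˣ) : Contracted P F) = 1 := Units.mul_inv _
  simp only [mul_assoc, add_mul, sub_mul, e, one_mul] at h'
  change -(cayley u : Contracted P F) * _ = _
  rw [neg_mul, add_comm _ (1 : Contracted P F), h', ← mul_neg, neg_sub]

/-! ### The Cayley map and the group operation -/

/-- A unipotent element has order a power of the odd characteristic. Odd order supplies square roots
as powers. -/
theorem exists_pow_eq_one [Finite F] (h2 : (2 : F) ≠ 0) {X : Contracted P F} (hX : X ∈ nil P F) :
    ∃ m : ℕ, (1 + X) ^ (2 * m + 1) = 1 := by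
  cases subsingleton_or_nontrivial (Contracted P F)
  · exact ⟨0, Subsingleton.elim _ _⟩
  obtain ⟨p, hp⟩ := CharP.exists F
  have : Fact p.Prime := ⟨CharP.char_is_prime F p⟩
  have : CharP (Contracted P F) p := charP_of_injective_algebraMap' F p
  have hp2 : p ≠ 2 := by
    rintro rfl
    exact h2 (by exact_mod_cast CharP.cast_eq_zero F 2)
  obtain ⟨r, hr⟩ := isNilpotent_of_mem_nil hX
  have hodd : Odd (p ^ r) := ((Fact.out : p.Prime).odd_of_ne_two hp2).pow
  obtain ⟨m, hm⟩ := hodd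
  refine ⟨m, ?_⟩
  rw [← hm, add_pow_char_pow_of_commute _ _ (Commute.one_left X), one_pow,
    pow_eq_zero_of_le (Nat.lt_pow_self (Fact.out : p.Prime).one_lt).le hr, add_zero]

theorem conj_coe (A : Contracted P F) (X : lieU P F) :
    (conj A X : Contracted P F) = A * X * dag A := rfl

theorem conj_mul (A B : Contracted P F) (X : lieU P F) : conj (A * B) X = conj A (conj B X) :=
  Subtype.ext (by simp only [conj_coe, dag_mul, mul_assoc])

theorem conj_one (X : lieU P F) : conj 1 X = X := Subtype.ext (by simp [conj_coe])

theorem dag_pow (A : Contracted P F) (m : ℕ) : dag (A ^ m) = dag A ^ m := by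
  induction m with
  | zero => simp
  | succ m ih => rw [pow_succ, dag_mul, ih, pow_succ']

/-- For `T ∈ 𝔲ᵃ`, an element `W` with `W (1 + X T) = T` is of the form `k T k†`. -/
theorem exists_conj_of_mul_eq [Finite F] (h2 : (2 : F) ≠ 0) (X T : lieU P F) (W : Contracted P F)
    (hW : W * (1 + (X : Contracted P F) * T) = T) :
    ∃ k : (Contracted P F)ˣ, W = conj (k : Contracted P F) T := by
  obtain ⟨a, ha⟩ := (isNilpotent_of_mem_nil
    (nil_mul_left (T : Contracted P F) X.2.1)).isUnit_one_add
  obtain ⟨m, hm⟩ := exists_pow_eq_one h2 (nil_mul_left (T : Contracted P F) X.2.1)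
  -- Since `a = 1 + T X` satisfies `a T = T a†`, the hypothesis gives `W = a⁻¹ T`. As `a⁻¹ = a ^ m *
  -- a ^ m`, one factor `a ^ m` can be moved across `T`.
  have hm' : a ^ (2 * m + 1) = 1 := Units.ext (by rw [Units.val_pow_eq_pow_val, ha, hm]; rfl)
  have hda : (dagUnit a : Contracted P F) = 1 + (X : Contracted P F) * T := by
    rw [coe_dagUnit, ha, dag_add, dag_one, dag_mul, X.2.2, T.2.2, neg_mul_neg]
  have hT : ∀ r, ((a ^ r : (Contracted P F)ˣ) : Contracted P F) * T =
      T * dag ((a ^ r : (Contracted P F)ˣ) : Contracted P F) := by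
    intro r
    rw [Units.val_pow_eq_pow_val, dag_pow, ← coe_dagUnit, hda, ha]
    induction r with
    | zero => simp
    | succ r ih => rw [pow_succ', mul_assoc, ih, pow_succ']; noncomm_ring
  refine ⟨a ^ m, (dagUnit a).isUnit.mul_right_cancel ?_⟩
  rw [hda, hW, ← hda, conj_coe, hT, mul_assoc, mul_assoc, coe_dagUnit, ← dag_mul, ← dag_mul,
    ← Units.val_mul, ← Units.val_mul, ← pow_succ', ← pow_add,
    (by omega : m + 1 + m = 2 * m + 1), hm', Units.val_one, dag_one, mul_one]

/-- Multiplying `u v ± 1` by `2 - X` on the left and `2 - Y` on the right clears both Cayley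
denominators. -/
theorem mul_product_aux {R : Type*} [Ring R] {X Y u v W : R} (hp : IsUnit (2 - X))
    (hu : (2 - X) * u = 2 + X) (hv : v * (2 - Y) = 2 + Y)
    (hW : W * (u * v + 1) = 2 * (u * v - 1)) :
    W * Ring.inverse (2 - X) * (8 + 2 * (X * Y)) = Ring.inverse (2 - X) * (8 * (X + Y)) := by
  obtain ⟨p, hp⟩ := hp
  have h8 : (8 : R) = (1 + 1) * ((1 + 1) * (1 + 1)) := by norm_num
  have e1 : (2 - X) * (u * v + 1) * (2 - Y) = 8 + 2 * (X * Y) := by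
    calc _ = ((2 - X) * u) * (v * (2 - Y)) + (2 - X) * (2 - Y) := by noncomm_ring
      _ = _ := by rw [hu, hv, h8, ← one_add_one_eq_two]; noncomm_ring
  have e2 : (2 - X) * (u * v - 1) * (2 - Y) = 4 * (X + Y) := by
    calc _ = ((2 - X) * u) * (v * (2 - Y)) - (2 - X) * (2 - Y) := by noncomm_ring
      _ = _ := by rw [hu, hv]; noncomm_ring
  have e3 : (8 : R) * (X + Y) = 2 * (4 * (X + Y)) := by noncomm_ring
  have h2 : Commute (2 : R) (2 - X) := Commute.ofNat_left 2 _
  rw [← e1, e3, ← e2, ← hp, Ring.inverse_unit]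
  have h3 : ((p⁻¹ : Rˣ) : R) * (2 * (p * (u * v - 1) * (2 - Y))) =
      2 * ((p⁻¹ : Rˣ) * p) * ((u * v - 1) * (2 - Y)) := by noncomm_ring
  rw [h3, Units.inv_mul, mul_one, ← mul_assoc 2, ← hW]
  simp only [mul_assoc, Units.inv_mul_cancel_left]

theorem conj_smul (c : F) (A : Contracted P F) (X : lieU P F) :
    conj (c • A) X = (c * c) • conj A X := by
  refine Subtype.ext ?_
  change c • A * (X : Contracted P F) * dag (c • A) = (c * c) • (A * X * dag A)
  rw [dag_smul, mul_smul_comm, smul_mul_assoc, smul_mul_assoc, smul_smul]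

theorem two_mul_cancel (h2 : (2 : F) ≠ 0) {A B : Contracted P F} (h : 2 * A = 2 * B) : A = B := by
  have hu : IsUnit (2 : Contracted P F) := by
    have := isUnit_two_add h2 (zero_mem (nil P F))
    rwa [add_zero] at this
  exact hu.mul_left_cancel h

/-- After conjugating `X + Y` by `(2 - X)⁻¹`, the equation of `mul_product_aux` takes the shape
treated in `exists_conj_of_mul_eq`. This replaces additivity of the Cayley map and is the source of
the multiplicativity of orbit sums. -/
theorem cayley_mul [Finite F] (h2 : (2 : F) ≠ 0) (u v : groupU P F) :
    ∃ g : (Contracted P F)ˣ, cayley (u * v) = conj (g : Contracted P F) (cayley u + cayley v) := by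
  have hp := isUnit_two_sub h2 (cayley u).2.1
  have h := mul_product_aux hp
    (two_sub_mul_of_mul_add_one (cayley_mul_add_one h2 u))
    (mul_two_sub_of_mul_add_one (isUnit_add_one h2 v) (cayley_mul_add_one h2 v))
    (cayley_mul_add_one h2 (u * v))
  generalize cayley (u * v) = W at h ⊢
  generalize cayley v = Y at h ⊢
  generalize cayley u = X at h hp ⊢
  obtain ⟨p, hp⟩ := hp
  rw [← hp, Ring.inverse_unit] at h
  have hdp : (dagUnit p : Contracted P F) = 2 + X := by
    rw [coe_dagUnit, hp, dag_sub, dag_two, X.2.2, sub_neg_eq_add]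
  have h4 : (4 : F) ≠ 0 := by
    rw [(by norm_num : (4 : F) = 2 * 2)]; exact mul_ne_zero h2 h2
  -- Here `p p† = (2 - X)(2 + X) = 4 - X²`, and the term `X (X + Y)` restores `X²`.
  have h8 : (8 : Contracted P F) + 2 * ((X : Contracted P F) * Y) =
      2 * ((p : Contracted P F) * dagUnit p + X * ((X : Contracted P F) + Y)) := by
    rw [hdp, hp, (by norm_num : (8 : Contracted P F) = (1 + 1) * ((1 + 1) * (1 + 1))),
      ← one_add_one_eq_two]
    noncomm_ring
  have hXp : Commute (X : Contracted P F) ((p⁻¹ : (Contracted P F)ˣ) : Contracted P F) := by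
    refine Commute.units_inv_right ?_
    rw [hp]
    exact (Commute.ofNat_right _ 2).sub_right (Commute.refl _)
  set q : (Contracted P F)ˣ := dagUnit p with hq
  have hW : (W : Contracted P F) * (1 + X * conj ((p⁻¹ : (Contracted P F)ˣ) : Contracted P F)
      (X + Y)) = 4 * conj ((p⁻¹ : (Contracted P F)ˣ) : Contracted P F) (X + Y) := by
    have hdi : dag ((p⁻¹ : (Contracted P F)ˣ) : Contracted P F) =
        ((q⁻¹ : (Contracted P F)ˣ) : Contracted P F) := rfl
    rw [conj_coe, hdi]
    refine two_mul_cancel h2 ((q.isUnit).mul_right_cancel ?_)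
    have e1 : (2 : Contracted P F) * (4 * (((p⁻¹ : (Contracted P F)ˣ) : Contracted P F) *
        ((X + Y : lieU P F) : Contracted P F) * ((q⁻¹ : (Contracted P F)ˣ) : Contracted P F))) * q =
        ((p⁻¹ : (Contracted P F)ˣ) : Contracted P F) * (8 * ((X : Contracted P F) + Y)) := by
      rw [← mul_assoc 2 4, (by norm_num : (2 : Contracted P F) * 4 = 8)]
      simp only [mul_assoc, Units.inv_mul, mul_one]
      exact (Commute.ofNat_left 8 _).left_comm _
    rw [e1, ← h, h8]
    have e2 : ((p⁻¹ : (Contracted P F)ˣ) : Contracted P F) * (2 * ((p : Contracted P F) * q +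
        X * ((X : Contracted P F) + Y))) = 2 * ((((p⁻¹ : (Contracted P F)ˣ) : Contracted P F) * p) *
          q + (((p⁻¹ : (Contracted P F)ˣ) : Contracted P F) * X) * ((X : Contracted P F) + Y)) := by
      noncomm_ring
    rw [mul_assoc (W : Contracted P F) _ (2 * _), e2, Units.inv_mul, one_mul, ← hXp.eq]
    have e3 : (X : Contracted P F) * (((p⁻¹ : (Contracted P F)ˣ) : Contracted P F) *
        ((X + Y : lieU P F) : Contracted P F) * ((q⁻¹ : (Contracted P F)ˣ) : Contracted P F)) * q =
        X * ((p⁻¹ : (Contracted P F)ˣ) : Contracted P F) * ((X : Contracted P F) + Y) := by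
      simp only [mul_assoc, Units.inv_mul, mul_one]; rfl
    rw [← e3]
    noncomm_ring
  -- The factor `4` is moved between the two arguments so that their product is unchanged; it is
  -- finally absorbed as conjugation by the scalar `2`.
  obtain ⟨k, hk⟩ := exists_conj_of_mul_eq h2 ((4⁻¹ : F) • X)
    ((4 : F) • conj ((p⁻¹ : (Contracted P F)ˣ) : Contracted P F) (X + Y)) W (by
      have e : (((4⁻¹ : F) • X : lieU P F) : Contracted P F) *
          (((4 : F) • conj ((p⁻¹ : (Contracted P F)ˣ) : Contracted P F) (X + Y) : lieU P F) :
            Contracted P F) = X * conj ((p⁻¹ : (Contracted P F)ˣ) : Contracted P F) (X + Y) := by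
        rw [Submodule.coe_smul, Submodule.coe_smul, smul_mul_smul_comm, inv_mul_cancel₀ h4,
          one_smul]
      rw [e, hW, Submodule.coe_smul, Algebra.smul_def, map_ofNat])
  refine ⟨k * (Units.map (algebraMap F (Contracted P F)).toMonoidHom (Units.mk0 2 h2) * p⁻¹), ?_⟩
  rw [Units.val_mul, Units.val_mul, conj_mul]
  refine Subtype.ext (hk.trans ?_)
  have e : ((Units.map (algebraMap F (Contracted P F)).toMonoidHom (Units.mk0 2 h2) :
      (Contracted P F)ˣ) : Contracted P F) * ((p⁻¹ : (Contracted P F)ˣ) : Contracted P F) =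
      (2 : F) • ((p⁻¹ : (Contracted P F)ˣ) : Contracted P F) := (Algebra.smul_def _ _).symm
  rw [e, conj_smul, (by norm_num : (2 : F) * 2 = 4)]

/-! ### The trace form and the self-duality of `𝔲ᵃ` -/

/-- The trace form `∑ X i j * Y j i`. -/
def tracePairing (X Y : Contracted P F) : F := ∑ i, ∑ j, X i j * Y j i

theorem tracePairing_comm (X Y : Contracted P F) : tracePairing X Y = tracePairing Y X := by
  unfold tracePairing
  rw [Finset.sum_comm]
  exact Finset.sum_congr rfl fun _ _ => Finset.sum_congr rfl fun _ _ => mul_comm _ _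

/-- For factors in the nilpotent ideal, the composability conditions on both sides say that `i → j →
k → i` goes exactly once around the circle of blocks. -/
theorem tracePairing_mul_left (A : Contracted P F) {X Y : Contracted P F} (hX : X ∈ nil P F)
    (hY : Y ∈ nil P F) : tracePairing (A * X) Y = tracePairing X (Y * A) := by
  have h1 : tracePairing (A * X) Y = ∑ i, ∑ k, ∑ j,
      if Composable (P.block i) (P.block j) (P.block k) then A i j * X j k * Y k i else 0 := by
    unfold tracePairing
    refine Finset.sum_congr rfl fun i _ => Finset.sum_congr rfl fun k _ => ?_
    simp only [mul_entry, Finset.sum_mul, ite_mul, zero_mul]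
  have h2 : tracePairing X (Y * A) = ∑ j, ∑ k, ∑ i,
      if Composable (P.block k) (P.block i) (P.block j) then A i j * X j k * Y k i else 0 := by
    unfold tracePairing
    refine Finset.sum_congr rfl fun j _ => Finset.sum_congr rfl fun k _ => ?_
    simp only [mul_entry, Finset.mul_sum, mul_ite, mul_zero]
    refine Finset.sum_congr rfl fun i _ => if_congr Iff.rfl (by ring) rfl
  rw [h1, h2, Finset.sum_congr rfl fun i _ => Finset.sum_comm, Finset.sum_comm]
  refine Finset.sum_congr rfl fun j _ => ?_
  rw [Finset.sum_comm]
  refine Finset.sum_congr rfl fun k _ => Finset.sum_congr rfl fun i _ => ?_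
  -- Cyclic symmetry of the condition can fail when `j, k` or `k, i` share a block, but there `X` or
  -- `Y` vanishes.
  by_cases hjk : P.block j = P.block k
  · simp [hX j k hjk]
  by_cases hki : P.block k = P.block i
  · simp [hY k i hki]
  refine if_congr ?_ rfl rfl
  unfold Composable
  omega

theorem tracePairing_mul_right (A : Contracted P F) {X Y : Contracted P F} (hX : X ∈ nil P F)
    (hY : Y ∈ nil P F) : tracePairing (X * A) Y = tracePairing X (A * Y) := by
  rw [tracePairing_comm, ← tracePairing_mul_left A hY hX, tracePairing_comm]

/-- The map from `𝔲ᵃ` to its dual given by the trace form. -/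
def toDual : lieU P F →ₗ[F] Module.Dual F (lieU P F) :=
  LinearMap.mk₂ F (fun Y X => tracePairing (X : Contracted P F) Y)
    (fun _ _ _ => by simp [tracePairing, mul_add, Finset.sum_add_distrib])
    (fun _ _ _ => by simp [tracePairing, Finset.mul_sum, mul_left_comm])
    (fun _ _ _ => by simp [tracePairing, add_mul, Finset.sum_add_distrib])
    (fun _ _ _ => by simp [tracePairing, Finset.mul_sum, mul_assoc])

theorem toDual_apply (Y X : lieU P F) :
    toDual Y X = tracePairing (X : Contracted P F) (Y : Contracted P F) := rfl

/-- Equivariance of the self-duality: orbits of linear forms become orbits of vectors. -/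
theorem toDual_comp_conj (A : Contracted P F) (Y : lieU P F) :
    toDual Y ∘ₗ conj (dag A) = toDual (conj A Y) := by
  ext X
  rw [LinearMap.comp_apply, toDual_apply, toDual_apply, conj_coe, conj_coe, dag_dag,
    tracePairing_mul_right _ (nil_mul_left _ X.2.1) Y.2.1,
    tracePairing_mul_left _ X.2.1 (nil_mul_left _ Y.2.1)]

/-- The pair of the opposite root. -/
def Root.swap (γ : Root P) : Root P := ⟨(γ.1.2, γ.1.1), γ.2.1.symm, γ.2.2.symm⟩

@[simp] theorem Root.swap_swap (γ : Root P) : γ.swap.swap = γ := rfl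

theorem prime_eq_iff (γ : Idx t n × Idx t n) : prime γ = γ ↔ γ.2 = -γ.1 := by
  rw [prime, Prod.ext_iff]
  constructor
  · intro h; exact h.2.symm
  · intro h; simp [h]

theorem tracePairing_unitMatrix (X : Contracted P F) (γ : Idx t n × Idx t n) :
    tracePairing X (unitMatrix P F γ) = X γ.2 γ.1 := by
  unfold tracePairing unitMatrix
  rw [Finset.sum_eq_single γ.2, Finset.sum_eq_single γ.1]
  · simp
  · intro j _ hj; rw [if_neg (fun h => hj (congrArg Prod.fst h)), mul_zero]
  · simp
  · intro i _ hi
    exact Finset.sum_eq_zero fun j _ => by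
      rw [if_neg (fun h => hi (congrArg Prod.snd h)), mul_zero]
  · simp

theorem tracePairing_sub_right (X Y Z : Contracted P F) :
    tracePairing X (Y - Z) = tracePairing X Y - tracePairing X Z := by
  simp [tracePairing, mul_sub, Finset.sum_sub_distrib]

theorem tracePairing_smul_right (c : F) (X Y : Contracted P F) :
    tracePairing X (c • Y) = c * tracePairing X Y := by
  simp [tracePairing, Finset.mul_sum, mul_left_comm]

theorem lieU_entry (X : lieU P F) (i j : Idx t n) :
    sign F i * sign F j * (X : Contracted P F) (-j) (-i) = -(X : Contracted P F) i j :=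
  congrFun (congrFun X.2.2 i) j

-- The trace form sees both entries of a root vector off the antidiagonal, and they contribute
-- equally. This is the origin of the factor `2`, compensated later by the weights `w` in
-- `exists_dualOrbit_eq`.
open Classical in
theorem toDual_rootVector (γ : Root P) :
    toDual (rootVector F γ) = (if IsAntidiagonal γ then (1 : F) else 2) • rootCoord F γ.swap := by
  ext X
  rw [toDual_apply, LinearMap.smul_apply, smul_eq_mul]
  change tracePairing (X : Contracted P F) (if prime γ.1 = γ.1 then unitMatrix P F γ.1
    else unitMatrix P F γ.1 - dag (unitMatrix P F γ.1)) = _ * (X : Contracted P F) γ.1.2 γ.1.1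
  by_cases h : IsAntidiagonal γ
  · rw [if_pos ((prime_eq_iff _).2 h), if_pos h, tracePairing_unitMatrix, one_mul]
  · rw [if_neg fun h' => h ((prime_eq_iff _).1 h'), if_neg h, tracePairing_sub_right,
      dag_unitMatrix, tracePairing_smul_right, tracePairing_unitMatrix, tracePairing_unitMatrix]
    have := lieU_entry X γ.1.2 γ.1.1
    simp only [prime]
    linear_combination -this

theorem toDual_injective (h2 : (2 : F) ≠ 0) :
    Function.Injective (toDual : lieU P F → Module.Dual F (lieU P F)) := by
  classical
  rw [injective_iff_map_eq_zero]
  intro Y hY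
  rw [← sum_rootCoord_smul h2 Y]
  refine Finset.sum_eq_zero fun γ _ => ?_
  have h := LinearMap.congr_fun hY (rootVector F γ.swap)
  rw [toDual_apply, tracePairing_comm, ← toDual_apply, toDual_rootVector, LinearMap.smul_apply,
    LinearMap.zero_apply, smul_eq_mul, Root.swap_swap] at h
  rw [(mul_eq_zero.1 h).resolve_left (by split_ifs <;> simp [h2]), zero_smul]

instance : Module.Finite F (Contracted P F) :=
  inferInstanceAs (Module.Finite F (Matrix (Idx t n) (Idx t n) F))

theorem toDual_bijective (h2 : (2 : F) ≠ 0) :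
    Function.Bijective (toDual : lieU P F → Module.Dual F (lieU P F)) :=
  ⟨toDual_injective h2, (LinearMap.injective_iff_surjective_of_finrank_eq_finrank
    (Subspace.dual_finrank_eq).symm).1 (toDual_injective h2)⟩

theorem dualOrbit_toDual (Y : lieU P F) : dualOrbit (toDual Y) = toDual '' orbit Y := by
  ext m
  constructor
  · rintro ⟨g, rfl⟩
    exact ⟨_, ⟨g, rfl⟩, (toDual_comp_conj _ _).symm⟩
  · rintro ⟨_, ⟨g, rfl⟩, rfl⟩
    exact ⟨g, (toDual_comp_conj _ _).symm⟩

/-! ### Orbits -/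

theorem mem_orbit_self (X : lieU P F) : X ∈ orbit X := ⟨1, by rw [Units.val_one, conj_one]⟩

theorem orbit_conj (g : (Contracted P F)ˣ) (X : lieU P F) :
    orbit (conj (g : Contracted P F) X) = orbit X := by
  ext Y
  constructor
  · rintro ⟨h, rfl⟩
    exact ⟨h * g, by rw [Units.val_mul, conj_mul]⟩
  · rintro ⟨h, rfl⟩
    exact ⟨h * g⁻¹, by rw [← conj_mul, ← Units.val_mul, inv_mul_cancel_right]⟩

theorem orbit_eq_of_mem {X Y : lieU P F} (h : Y ∈ orbit X) : orbit Y = orbit X := by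
  obtain ⟨g, rfl⟩ := h
  exact orbit_conj g X

theorem orbit_zero : orbit (0 : lieU P F) = {0} := by
  ext Y
  constructor
  · rintro ⟨g, rfl⟩; simp
  · rintro rfl; exact mem_orbit_self _

/-! ### Orbit sums -/

section OrbitSums

instance [Finite F] : Finite (Contracted P F) := inferInstanceAs (Finite (Matrix (Idx t n) (Idx t n) F))

instance [Finite F] : Finite (Module.Dual F (lieU P F)) :=
  Finite.of_injective (fun f => (f : lieU P F → F)) DFunLike.coe_injective

/-- The sum of the functions `u ↦ ε^{μ(f(u))}` over `μ ∈ O`. -/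
def orbitSum (ε : AddChar F ℂ) (O : Set (Module.Dual F (lieU P F))) : groupU P F → ℂ :=
  fun u => ∑ᶠ μ ∈ O, ε (μ (cayley u))

/-- Invariance of a set of linear forms under the group of the algebra. -/
def IsStable (O : Set (Module.Dual F (lieU P F))) : Prop :=
  ∀ g : (Contracted P F)ˣ, ∀ μ ∈ O, μ ∘ₗ conj (g : Contracted P F) ∈ O

theorem isStable_dualOrbit (l : Module.Dual F (lieU P F)) : IsStable (dualOrbit l) := by
  rintro g _ ⟨h, rfl⟩
  refine ⟨dagUnit g * h, ?_⟩
  ext X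
  simp only [LinearMap.comp_apply, Units.val_mul, dag_mul, coe_dagUnit, dag_dag, conj_mul]

/-- The action permutes a stable set, so the sum is merely reindexed. -/
theorem finsum_conj {O : Set (Module.Dual F (lieU P F))} (hO : IsStable O) (ε : AddChar F ℂ)
    (g : (Contracted P F)ˣ) (X : lieU P F) :
    ∑ᶠ μ ∈ O, ε (μ (conj (g : Contracted P F) X)) = ∑ᶠ μ ∈ O, ε (μ X) := by
  refine finsum_mem_eq_of_bijOn (fun μ => μ ∘ₗ conj (g : Contracted P F))
    ⟨fun μ hμ => hO g μ hμ, ?_, ?_⟩ fun μ _ => rfl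
  · intro μ _ ν _ h
    ext Y
    have := LinearMap.congr_fun h (conj ((g⁻¹ : (Contracted P F)ˣ) : Contracted P F) Y)
    simpa only [LinearMap.comp_apply, ← conj_mul, ← Units.val_mul, mul_inv_cancel, Units.val_one,
      conj_one] using this
  · intro μ hμ
    refine ⟨_, hO g⁻¹ μ hμ, ?_⟩
    ext Y
    simp only [LinearMap.comp_apply, ← conj_mul, ← Units.val_mul, inv_mul_cancel, Units.val_one,
      conj_one]

/-- The Cayley bijection turns this into the sum over `𝔲ᵃ` of the additive character `ε ∘ (ν - μ)`,
which is nontrivial because a nonzero linear form is surjective. -/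
theorem sum_cayley_pair [Finite F] [Fintype (groupU P F)] (h2 : (2 : F) ≠ 0) {ε : AddChar F ℂ} (hε : ε ≠ 1)
    {μ ν : Module.Dual F (lieU P F)} (h : μ ≠ ν) :
    ∑ u : groupU P F, ε (μ (cayley u⁻¹)) * ε (ν (cayley u)) = 0 := by
  have := Fintype.ofFinite (lieU P F)
  let ψ : AddChar (lieU P F) ℂ := ε.compAddMonoidHom (ν - μ).toAddMonoidHom
  have hψ : ψ ≠ 1 := by
    intro hψ
    refine hε (DFunLike.ext _ _ fun c => ?_)
    have hs : Function.Surjective (ν - μ) :=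
      LinearMap.surjective_of_ne_zero (sub_ne_zero.2 h.symm)
    obtain ⟨X, rfl⟩ := hs c
    exact DFunLike.congr_fun hψ X
  rw [← AddChar.sum_eq_zero_of_ne_one hψ,
    ← (Equiv.ofBijective _ ⟨cayley_injective h2, cayley_surjective h2⟩).sum_comp]
  refine Finset.sum_congr rfl fun u _ => ?_
  rw [cayley_inv h2, map_neg, ← AddChar.map_add_eq_mul]
  change _ = ε (ν (cayley u) - μ (cayley u))
  rw [neg_add_eq_sub]

theorem sum_cayley_self [Fintype (groupU P F)] (h2 : (2 : F) ≠ 0) (ε : AddChar F ℂ)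
    (μ : Module.Dual F (lieU P F)) :
    ∑ u : groupU P F, ε (μ (cayley u⁻¹)) * ε (μ (cayley u)) = Fintype.card (groupU P F) := by
  simp only [cayley_inv h2, map_neg, ← AddChar.map_add_eq_mul, neg_add_cancel,
    AddChar.map_zero_eq_one, Finset.sum_const, Finset.card_univ, nsmul_eq_mul, mul_one]

theorem orbitSum_mul [Finite F] (h2 : (2 : F) ≠ 0) {O : Set (Module.Dual F (lieU P F))} (hO : IsStable O)
    (ε : AddChar F ℂ) (u v : groupU P F) :
    orbitSum ε O (u * v) = ∑ᶠ μ ∈ O, ε (μ (cayley u)) * ε (μ (cayley v)) := by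
  obtain ⟨g, hg⟩ := cayley_mul h2 u v
  unfold orbitSum
  rw [hg, finsum_conj hO]
  simp only [map_add, AddChar.map_add_eq_mul]

theorem isCharacter_orbitSum [Finite F] (h2 : (2 : F) ≠ 0) {ε : AddChar F ℂ} (hε : ε ≠ 1)
    {O : Set (Module.Dual F (lieU P F))} (hO : IsStable O) (hne : O.Nonempty) :
    IsCharacter (orbitSum ε O) := by
  have := Fintype.ofFinite (groupU P F)
  have := Fintype.ofFinite O
  have := hne.to_subtype
  refine isCharacter_of_sum_mul (ι := O) (fun μ u => ε (μ.1 (cayley u))) _ ?_ ?_ ?_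
  · intro u v
    rw [orbitSum_mul h2 hO, ← finsum_set_coe_eq_finsum_mem, finsum_eq_sum_of_fintype]
  · exact fun μ ν h => sum_cayley_pair h2 hε fun h' => h (Subtype.ext h')
  · exact fun μ => sum_cayley_self h2 ε μ.1

theorem sum_orbitSum_mul [Fintype (groupU P F)] (ε : AddChar F ℂ)
    (O O' : Set (Module.Dual F (lieU P F))) [Fintype O] [Fintype O'] :
    ∑ u : groupU P F, orbitSum ε O' u * orbitSum ε O u⁻¹ =
      ∑ μ : O, ∑ ν : O', ∑ u : groupU P F, ε (μ.1 (cayley u⁻¹)) * ε (ν.1 (cayley u)) := by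
  simp only [orbitSum, ← finsum_set_coe_eq_finsum_mem, finsum_eq_sum_of_fintype,
    Finset.sum_mul_sum]
  rw [Finset.sum_comm, Finset.sum_congr rfl fun ν _ => Finset.sum_comm, Finset.sum_comm]
  refine Finset.sum_congr rfl fun μ _ => Finset.sum_congr rfl fun ν _ =>
    Finset.sum_congr rfl fun u _ => mul_comm _ _

theorem sum_orbitSum_mul_eq_zero [Finite F] [Fintype (groupU P F)] (h2 : (2 : F) ≠ 0) {ε : AddChar F ℂ}
    (hε : ε ≠ 1) {O O' : Set (Module.Dual F (lieU P F))} (h : Disjoint O O') :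
    ∑ u : groupU P F, orbitSum ε O' u * orbitSum ε O u⁻¹ = 0 := by
  have := Fintype.ofFinite O
  have := Fintype.ofFinite O'
  rw [sum_orbitSum_mul]
  exact Finset.sum_eq_zero fun μ _ => Finset.sum_eq_zero fun ν _ =>
    sum_cayley_pair h2 hε fun e => Set.disjoint_left.1 h μ.2 (e ▸ ν.2)

theorem sum_orbitSum_mul_self_ne_zero [Finite F] [Fintype (groupU P F)] (h2 : (2 : F) ≠ 0) {ε : AddChar F ℂ}
    (hε : ε ≠ 1) {O : Set (Module.Dual F (lieU P F))} (hO : O.Nonempty) :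
    ∑ u : groupU P F, orbitSum ε O u * orbitSum ε O u⁻¹ ≠ 0 := by
  have := Fintype.ofFinite O
  have := hO.to_subtype
  have h : ∀ μ : O, ∑ ν : O, ∑ u : groupU P F, ε (μ.1 (cayley u⁻¹)) * ε (ν.1 (cayley u)) =
      Fintype.card (groupU P F) := by
    intro μ
    rw [Finset.sum_eq_single μ]
    · exact sum_cayley_self h2 ε μ.1
    · exact fun ν _ hν => sum_cayley_pair h2 hε fun e => hν (Subtype.ext e.symm)
    · simp
  rw [sum_orbitSum_mul]
  simp only [h, Finset.sum_const, Finset.card_univ, nsmul_eq_mul]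
  exact mul_ne_zero (Nat.cast_ne_zero.2 Fintype.card_ne_zero)
    (Nat.cast_ne_zero.2 Fintype.card_ne_zero)

end OrbitSums

/-! ### Entries of elements of `𝔲ᵃ` and of root vectors -/

theorem sign_ne_zero (i : Idx t n) : sign F i ≠ 0 := left_ne_zero_of_mul
  (by rw [sign_mul_self]; exact one_ne_zero : sign F i * sign F i ≠ 0)

theorem lieU_entry_ne_zero_iff (X : lieU P F) (i j : Idx t n) :
    (X : Contracted P F) (-j) (-i) ≠ 0 ↔ (X : Contracted P F) i j ≠ 0 := by
  rw [← neg_ne_zero (a := (X : Contracted P F) i j), ← lieU_entry]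
  simp [sign_ne_zero]

theorem lieU_entry_eq_zero_iff (X : lieU P F) (i j : Idx t n) :
    (X : Contracted P F) (-j) (-i) = 0 ↔ (X : Contracted P F) i j = 0 :=
  not_iff_not.1 (lieU_entry_ne_zero_iff X i j)

theorem lieU_antidiagonal_eq_zero (h2 : (2 : F) ≠ 0) (ht : t ≠ Series.C) (X : lieU P F)
    (i : Idx t n) : (X : Contracted P F) i (-i) = 0 := by
  have h := lieU_entry X i (-i)
  rw [sign_mul_sign_neg, if_neg ht, one_mul, neg_neg] at h
  exact (mul_eq_zero.1 (by linear_combination h :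
    (2 : F) * (X : Contracted P F) i (-i) = 0)).resolve_left h2

theorem rootVector_entry_self (γ : Root P) :
    (rootVector F γ : Contracted P F) γ.1.1 γ.1.2 = 1 := by
  have := rootCoord_rootVector (F := F) γ γ
  rwa [if_pos rfl] at this

theorem rootVector_entry_eq_zero {γ : Root P} {i j : Idx t n} (h : (i, j) ≠ γ.1)
    (h' : (i, j) ≠ prime γ.1) : (rootVector F γ : Contracted P F) i j = 0 := by
  have h1 : unitMatrix P F γ.1 i j = 0 := if_neg h
  have h2 : unitMatrix P F (prime γ.1) i j = 0 := if_neg h'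
  unfold rootVector
  by_cases hp : prime γ.1 = γ.1
  · simp only [if_pos hp, h1]
  · simp only [if_neg hp, sub_entry, h1, dag_unitMatrix, smul_entry, h2, mul_zero, sub_zero]

/-! ### Supports and elementary transformations -/

/-- The nonzero rows of `X` have labels in `A`. -/
def RowsIn (A : Finset (Idx t n)) (X : Contracted P F) : Prop := ∀ i j, i ∉ A → X i j = 0

theorem RowsIn.mul {A : Finset (Idx t n)} {X : Contracted P F} (hX : RowsIn A X)
    (Y : Contracted P F) : RowsIn A (X * Y) := by
  intro i k hi
  rw [mul_entry]
  exact Finset.sum_eq_zero fun j _ => by simp [hX i j hi]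

theorem RowsIn.add {A : Finset (Idx t n)} {X Y : Contracted P F} (hX : RowsIn A X)
    (hY : RowsIn A Y) : RowsIn A (X + Y) := by
  intro i k hi
  rw [add_entry, hX i k hi, hY i k hi, add_zero]

/-- Left multiplication by `g` does not change matrices whose rows with labels in `A` vanish. -/
def ActsOn (A : Finset (Idx t n)) (g : (Contracted P F)ˣ) : Prop :=
  ∀ Z : Contracted P F, (∀ i j, i ∈ A → Z i j = 0) → (g : Contracted P F) * Z = Z

theorem ActsOn.mul {A : Finset (Idx t n)} {g h : (Contracted P F)ˣ} (hg : ActsOn A g)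
    (hh : ActsOn A h) : ActsOn A (g * h) := by
  intro Z hZ
  rw [Units.val_mul, mul_assoc, hh Z hZ, hg Z hZ]

theorem ActsOn.mono {A B : Finset (Idx t n)} (h : A ⊆ B) {g : (Contracted P F)ˣ}
    (hg : ActsOn A g) : ActsOn B g :=
  fun Z hZ => hg Z fun i j hi => hZ i j (h hi)

/-- Root vectors already split off stay fixed while the elimination continues in the remaining rows.
-/
theorem ActsOn.conj_eq {A : Finset (Idx t n)} {g : (Contracted P F)ˣ} (hg : ActsOn A g)
    (X : lieU P F) (hX : ∀ i j, i ∈ A → (X : Contracted P F) i j = 0) :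
    conj (g : Contracted P F) X = X := by
  refine Subtype.ext ?_
  have h := congrArg dag (hg X hX)
  rw [dag_mul, X.2.2, neg_mul, neg_inj] at h
  rw [conj_coe, mul_assoc, h, hg X hX]

/-- The invertible element `1 + C` for `C ^ 2 = 0`. -/
def oneAddUnit (C : Contracted P F) (h : C * C = 0) : (Contracted P F)ˣ where
  val := 1 + C
  inv := 1 - C
  val_inv := by rw [add_mul, one_mul, mul_sub, h]; simp
  inv_val := by rw [sub_mul, one_mul, mul_add, h]; simp

theorem mul_eq_zero_of_rows {C Z : Contracted P F} (h : ∀ l m k, C l m ≠ 0 → Z m k = 0) :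
    C * Z = 0 := by
  ext l k
  rw [mul_entry]
  refine Finset.sum_eq_zero fun m _ => ?_
  by_cases hC : C l m = 0
  · simp [hC]
  · simp [h l m k hC]

theorem actsOn_oneAddUnit {A : Finset (Idx t n)} {C : Contracted P F} (h : C * C = 0)
    (hC : ∀ l m, m ∉ A → C l m = 0) : ActsOn A (oneAddUnit C h) := by
  intro Z hZ
  change (1 + C) * Z = Z
  rw [add_mul, one_mul, mul_eq_zero_of_rows, add_zero]
  intro l m k hlm
  refine hZ m k ?_
  by_contra hm
  exact hlm (hC l m hm)

theorem rowsIn_conj_oneAddUnit {A : Finset (Idx t n)} {C : Contracted P F} (h : C * C = 0)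
    (hC : RowsIn A C) {X : lieU P F} (hX : RowsIn A (X : Contracted P F)) :
    RowsIn A (conj (oneAddUnit C h : Contracted P F) X : Contracted P F) := by
  rw [conj_coe]
  change RowsIn A ((1 + C) * (X : Contracted P F) * dag (1 + C))
  rw [add_mul, one_mul]
  exact (hX.add (hC.mul _)).mul _

theorem conj_oneAddUnit_coe {C : Contracted P F} (h : C * C = 0) (X : lieU P F) :
    (conj (oneAddUnit C h : Contracted P F) X : Contracted P F) =
      (X : Contracted P F) + C * X - dag (C * (X : Contracted P F)) + C * X * dag C := by
  rw [conj_coe]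
  change (1 + C) * (X : Contracted P F) * dag (1 + C) = _
  rw [dag_add, dag_one, dag_mul, X.2.2]
  noncomm_ring

/-- Multiplication by any element of the algebra does not lower cyclic distance, so a minimal pivot
stays minimal under conjugation. -/
theorem SupportedFrom.conj {N m : ℤ} (hN : 0 < N) (hb : ∀ i j, P.block i - P.block j < N)
    {X : lieU P F} (hX : SupportedFrom N m (X : Contracted P F)) (A : Contracted P F) :
    SupportedFrom N m (conj A X : Contracted P F) := by
  have := ((supportedFrom_zero hb A).mul hN hX).mul hN (supportedFrom_zero hb (dag A))
  rwa [zero_add, add_zero] at this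

theorem cycDist_neg (N a b : ℤ) : cycDist N (-b) (-a) = cycDist N a b := by
  unfold cycDist
  split_ifs <;> omega

/-- If `b` is not farther from `c` than `a` is, the path from `a` to `c` passes through `b`. Hence a
row of minimal distance can be added to every row that has to be cleared. -/
theorem composable_of_cycDist_le {N a b c : ℤ} (hab : a - b < N)
    (h : cycDist N b c ≤ cycDist N a c) : Composable a b c := by
  unfold cycDist at h
  unfold Composable
  split_ifs at h <;> omega

/-! ### Clearing the columns of a pivot -/

/-- One transvection uses row `i` to clear column `j` and row `-j` to clear column `-i`. By `h0` the
two operations do not interfere, and the matching column operations leave these two columns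
untouched. -/
theorem exists_conj_clear {A : Finset (Idx t n)} {X : lieU P F}
    (hX : RowsIn A (X : Contracted P F)) {i j : Idx t n} (hs : (X : Contracted P F) i j ≠ 0)
    (hj : ∀ l, (X : Contracted P F) l j ≠ 0 → Composable (P.block l) (P.block i) (P.block j))
    (hi : ∀ l, (X : Contracted P F) l (-i) ≠ 0 →
      Composable (P.block l) (P.block (-j)) (P.block (-i)))
    (h0 : i ≠ -j → (X : Contracted P F) (-j) j = 0 ∧ (X : Contracted P F) i (-i) = 0) :
    ∃ g : (Contracted P F)ˣ, ActsOn A g ∧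
      RowsIn A (conj (g : Contracted P F) X : Contracted P F) ∧
      (conj (g : Contracted P F) X : Contracted P F) i j = (X : Contracted P F) i j ∧
      (∀ l, l ≠ i → (conj (g : Contracted P F) X : Contracted P F) l j = 0) ∧
      (∀ l, l ≠ -j → (conj (g : Contracted P F) X : Contracted P F) l (-i) = 0) := by
  have hs' := (lieU_entry_ne_zero_iff X i j).2 hs
  have hiA : i ∈ A := by by_contra h; exact hs (hX i j h)
  have hjA : -j ∈ A := by by_contra h; exact hs' (hX _ _ h)
  -- Column `i` of `C` holds the multipliers for clearing column `j`, and column `-j` those for the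
  -- mirror pivot `(-j, -i)`; for `i = -j` the two coincide.
  let C : Contracted P F := fun l m => if m = i then (if l = i then 0 else
    -(X : Contracted P F) l j / (X : Contracted P F) i j) else if m = -j then (if l = -j then 0
    else -(X : Contracted P F) l (-i) / (X : Contracted P F) (-j) (-i)) else 0
  have hCi : ∀ l, l ≠ i → C l i = -(X : Contracted P F) l j / (X : Contracted P F) i j := by
    exact fun l hl => (if_pos rfl).trans (if_neg hl)
  have hCj : i ≠ -j → ∀ l, l ≠ -j → C l (-j) =
      -(X : Contracted P F) l (-i) / (X : Contracted P F) (-j) (-i) := by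
    exact fun h l hl => (if_neg h.symm).trans ((if_pos rfl).trans (if_neg hl))
  have hC0 : ∀ l m, m ≠ i → m ≠ -j → C l m = 0 := by
    exact fun l m h1 h2 => (if_neg h1).trans (if_neg h2)
  have hrowi : ∀ m, C i m = 0 := by
    intro m
    simp only [C]
    split_ifs with h1 h2 h3
    · rfl
    · rfl
    · rw [(h0 fun e => h1 (h2.trans e.symm)).2]; simp
    · rfl
  have hrowj : ∀ m, C (-j) m = 0 := by
    intro m
    simp only [C]
    split_ifs with h1 h2 h3
    · rfl
    · rw [(h0 fun e => h2 e.symm).1]; simp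
    · rfl
    · rfl
  have hCC : C * C = 0 := mul_eq_zero_of_rows fun l m k h => by
    by_cases h1 : m = i
    · subst h1; exact hrowi k
    by_cases h2 : m = -j
    · subst h2; exact hrowj k
    exact absurd (hC0 l m h1 h2) h
  -- Rows `i` and `-j` of `C` vanish, so right multiplication by `1 + C†` does not change columns
  -- `-i` and `j`.
  have hcol : ∀ r c, -c = i ∨ -c = -j → (conj (oneAddUnit C hCC : Contracted P F) X :
      Contracted P F) r c = (X : Contracted P F) r c + (C * (X : Contracted P F)) r c := by
    intro r c hc
    have hz : ∀ m, C (-c) m = 0 := by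
      intro m; rcases hc with hc | hc <;> rw [hc]
      exacts [hrowi m, hrowj m]
    have h1 : dag (C * (X : Contracted P F)) r c = 0 := by
      rw [dag_entry, mul_entry]
      simp [hz]
    have h2 : (C * (X : Contracted P F) * dag C) r c = 0 := by
      rw [mul_entry]
      refine Finset.sum_eq_zero fun m _ => ?_
      simp [dag_entry, hz]
    rw [conj_oneAddUnit_coe, add_entry, sub_entry, add_entry, h1, h2, sub_zero, add_zero]
  have hclj : ∀ l, l ≠ i → (C * (X : Contracted P F)) l j = -(X : Contracted P F) l j := by
    intro l hl
    rw [mul_entry, Finset.sum_eq_single i]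
    · rw [hCi l hl, div_mul_cancel₀ _ hs]
      split_ifs with hc
      · rfl
      · rw [eq_comm, neg_eq_zero]
        by_contra h
        exact hc (hj l h)
    · intro m _ hm
      by_cases h2 : m = -j
      · subst h2; simp [(h0 hm.symm).1]
      · simp [hC0 l m hm h2]
    · simp
  have hclj0 : (C * (X : Contracted P F)) i j = 0 := by
    rw [mul_entry]; simp [hrowi]
  have hcli : i ≠ -j → ∀ l, l ≠ -j →
      (C * (X : Contracted P F)) l (-i) = -(X : Contracted P F) l (-i) := by
    intro hij l hl
    rw [mul_entry, Finset.sum_eq_single (-j)]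
    · rw [hCj hij l hl, div_mul_cancel₀ _ hs']
      split_ifs with hc
      · rfl
      · rw [eq_comm, neg_eq_zero]
        by_contra h
        exact hc (hi l h)
    · intro m _ hm
      by_cases h2 : m = i
      · subst h2; simp [(h0 hij).2]
      · simp [hC0 l m h2 hm]
    · simp
  have hY : ∀ l, l ≠ i →
      (conj (oneAddUnit C hCC : Contracted P F) X : Contracted P F) l j = 0 := by
    intro l hl
    rw [hcol l j (Or.inr rfl), hclj l hl, add_neg_cancel]
  refine ⟨oneAddUnit C hCC, actsOn_oneAddUnit hCC ?_, rowsIn_conj_oneAddUnit hCC ?_ hX, ?_, hY, ?_⟩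
  · intro l m hm
    exact hC0 l m (fun e => hm (e ▸ hiA)) (fun e => hm (e ▸ hjA))
  · intro l m hl
    simp only [C, hX l _ hl]
    simp
  · rw [hcol i j (Or.inr rfl), hclj0, add_zero]
  · intro l hl
    by_cases hij : i = -j
    · have hj' : -i = j := by rw [hij, neg_neg]
      rw [hj']
      exact hY l (by rwa [hij])
    · rw [hcol l (-i) (Or.inl (neg_neg i)), hcli hij l hl, add_neg_cancel]

/-- Subtracting the pivot empties columns `j` and `-i`, and by antisymmetry rows `-j` and `i`. The
remainder involves fewer labels, which is the induction step. -/
theorem rowsIn_sub_smul_rootVector {A : Finset (Idx t n)} {Y : lieU P F}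
    (hY : RowsIn A (Y : Contracted P F)) (γ : Root P)
    (hs : (Y : Contracted P F) γ.1.1 γ.1.2 ≠ 0)
    (hj : ∀ l, l ≠ γ.1.1 → (Y : Contracted P F) l γ.1.2 = 0)
    (hi : ∀ l, l ≠ -γ.1.2 → (Y : Contracted P F) l (-γ.1.1) = 0) :
    RowsIn (A \ {γ.1.1, -γ.1.2})
      ((Y - (Y : Contracted P F) γ.1.1 γ.1.2 • rootVector F γ : lieU P F) : Contracted P F) := by
  set s := (Y : Contracted P F) γ.1.1 γ.1.2 with hs_def
  have hs' := (lieU_entry_ne_zero_iff Y _ _).2 hs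
  have hiA : γ.1.1 ∈ A := by by_contra h; exact hs (hY _ _ h)
  have hjA : -γ.1.2 ∈ A := by by_contra h; exact hs' (hY _ _ h)
  set Z : lieU P F := Y - s • rootVector F γ with hZ
  have hZe : ∀ l m, (Z : Contracted P F) l m =
      (Y : Contracted P F) l m - s * (rootVector F γ : Contracted P F) l m := fun _ _ => rfl
  have hcj : ∀ l, (Z : Contracted P F) l γ.1.2 = 0 := by
    intro l
    rw [hZe]
    by_cases hl : l = γ.1.1
    · rw [hl, rootVector_entry_self, mul_one, ← hs_def, sub_self]
    · rw [hj l hl, rootVector_entry_eq_zero, mul_zero, sub_zero]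
      · exact fun e => hl (congrArg Prod.fst e)
      · intro e
        have e1 : l = -γ.1.2 := congrArg Prod.fst e
        have e2 : γ.1.2 = -γ.1.1 := congrArg Prod.snd e
        exact hl (by rw [e1, e2, neg_neg])
  have hci : ∀ l, (Z : Contracted P F) l (-γ.1.1) = 0 := by
    intro l
    by_cases hl : l = -γ.1.2
    · rw [hl, lieU_entry_eq_zero_iff]
      exact hcj _
    · rw [hZe, hi l hl, rootVector_entry_eq_zero, mul_zero, sub_zero]
      · intro e
        have e1 : l = γ.1.1 := congrArg Prod.fst e
        have e2 : -γ.1.1 = γ.1.2 := congrArg Prod.snd e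
        exact hl (by rw [e1, ← e2, neg_neg])
      · exact fun e => hl (congrArg Prod.fst e)
  intro l m hl
  by_cases h1 : l = γ.1.1
  · subst h1
    rw [← lieU_entry_eq_zero_iff]
    exact hci _
  by_cases h2 : l = -γ.1.2
  · rw [h2, ← lieU_entry_eq_zero_iff, neg_neg]
    exact hcj _
  have hlA : l ∉ A := by
    intro h
    exact hl (by simp [h, h1, h2])
  rw [hZe, hY l m hlA, rootVector_entry_eq_zero, mul_zero, sub_zero]
  · exact fun e => h1 (congrArg Prod.fst e)
  · exact fun e => h2 (congrArg Prod.fst e)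

/-! ### Pivots -/

theorem smul_unitMatrix_mul_entry (c : F) (a b : Idx t n) (X : Contracted P F) (l m : Idx t n) :
    (c • unitMatrix P F (a, b) * X) l m =
      if l = a ∧ Composable (P.block a) (P.block b) (P.block m) then c * X b m else 0 := by
  rw [mul_entry, Finset.sum_eq_single b]
  · simp only [smul_entry, unitMatrix, Prod.mk.injEq, and_true]
    by_cases hl : l = a
    · subst hl; simp
    · simp [hl]
  · intro j _ hj
    simp [unitMatrix, hj]
  · simp

/-- In the symplectic case, adding `c` times row `i` to row `-j` changes the antidiagonal entry at
`(-j, j)` by `2 c X i j`. -/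
theorem exists_conj_add_row (ht : t = Series.C) {A : Finset (Idx t n)} {X : lieU P F}
    (hX : RowsIn A (X : Contracted P F)) {i j : Idx t n} (hij : i ≠ -j)
    (hs : (X : Contracted P F) i j ≠ 0) (c : F)
    (hc : c ≠ 0 → Composable (P.block (-j)) (P.block i) (P.block j))
    (h0 : Composable (P.block (-j)) (P.block i) (P.block (-i)) →
      (X : Contracted P F) i (-i) = 0) :
    ∃ g : (Contracted P F)ˣ, ActsOn A g ∧
      RowsIn A (conj (g : Contracted P F) X : Contracted P F) ∧
      (conj (g : Contracted P F) X : Contracted P F) i j = (X : Contracted P F) i j ∧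
      (conj (g : Contracted P F) X : Contracted P F) i (-i) = (X : Contracted P F) i (-i) ∧
      (conj (g : Contracted P F) X : Contracted P F) (-j) j =
        (X : Contracted P F) (-j) j + 2 * c * (X : Contracted P F) i j := by
  have hiA : i ∈ A := by by_contra h; exact hs (hX i j h)
  have hjA : -j ∈ A := by by_contra h; exact (lieU_entry_ne_zero_iff X i j).2 hs (hX _ _ h)
  have hCe : ∀ l m, m ≠ i → (c • unitMatrix P F (-j, i)) l m = 0 := by
    intro l m hm; simp [unitMatrix, hm]
  have hCr : ∀ l m, l ≠ -j → (c • unitMatrix P F (-j, i)) l m = 0 := by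
    intro l m hm; simp [unitMatrix, hm]
  have hCC : (c • unitMatrix P F (-j, i)) * (c • unitMatrix P F (-j, i)) = 0 :=
    mul_eq_zero_of_rows fun l m k h => by
      have hm : m = i := by by_contra hm; exact h (hCe l m hm)
      subst hm
      exact hCr _ _ hij
  have hrow : ∀ l m, l ≠ -j → ((c • unitMatrix P F (-j, i)) * (X : Contracted P F)) l m = 0 := by
    intro l m hl
    rw [smul_unitMatrix_mul_entry, if_neg fun h => hl h.1]
  have hz : ((c • unitMatrix P F (-j, i)) * (X : Contracted P F)) (-j) (-i) = 0 := by
    rw [smul_unitMatrix_mul_entry]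
    split_ifs with h
    · rw [h0 h.2, mul_zero]
    · rfl
  have hjj : ((c • unitMatrix P F (-j, i)) * (X : Contracted P F)) (-j) j =
      c * (X : Contracted P F) i j := by
    rw [smul_unitMatrix_mul_entry]
    by_cases hc0 : c = 0
    · simp [hc0]
    · rw [if_pos ⟨rfl, hc hc0⟩]
  have hrow' : ∀ m, ((c • unitMatrix P F (-j, i)) * (X : Contracted P F) *
      dag (c • unitMatrix P F (-j, i))) i m = 0 := by
    intro m
    rw [mul_entry]
    exact Finset.sum_eq_zero fun k _ => by simp [hrow i k hij]
  have hjj' : ((c • unitMatrix P F (-j, i)) * (X : Contracted P F) *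
      dag (c • unitMatrix P F (-j, i))) (-j) j = 0 := by
    rw [mul_entry]
    refine Finset.sum_eq_zero fun k _ => ?_
    by_cases hk : k = -i
    · subst hk; simp [hz]
    · rw [dag_entry, hCe (-j) (-k) (fun e => hk (by rw [← e, neg_neg]))]
      simp
  refine ⟨oneAddUnit _ hCC, actsOn_oneAddUnit hCC ?_, rowsIn_conj_oneAddUnit hCC ?_ hX, ?_⟩
  · exact fun l m hm => hCe l m fun e => hm (e ▸ hiA)
  · exact fun l m hl => hCr l m fun e => hl (e ▸ hjA)
  simp only [conj_oneAddUnit_coe, add_entry, sub_entry, hrow', hrow i _ hij, hjj, hjj', add_zero]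
  refine ⟨?_, ?_, ?_⟩
  · rw [dag_entry, hz, mul_zero, sub_zero]
  · rw [dag_entry, neg_neg, hrow i _ hij, mul_zero, sub_zero]
  · rw [dag_entry, neg_neg, hjj, mul_comm (sign F (-j)), sign_mul_sign_neg, if_pos ht]
    ring

/-- A nonzero element of `𝔲ᵃ` has a nonzero root coordinate of minimal cyclic distance. -/
theorem exists_minimal_root (h2 : (2 : F) ≠ 0) (N : ℤ) {X : lieU P F} (hX : X ≠ 0) :
    ∃ γ : Root P, (X : Contracted P F) γ.1.1 γ.1.2 ≠ 0 ∧
      SupportedFrom N (cycDist N (P.block γ.1.1) (P.block γ.1.2)) (X : Contracted P F) := by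
  classical
  have hne : (Finset.univ.filter fun γ : Root P =>
      (X : Contracted P F) γ.1.1 γ.1.2 ≠ 0).Nonempty := by
    by_contra h
    rw [Finset.not_nonempty_iff_eq_empty, Finset.filter_eq_empty_iff] at h
    refine hX ?_
    rw [← sum_rootCoord_smul h2 X]
    refine Finset.sum_eq_zero fun γ hγ => ?_
    have h0 : rootCoord F γ X = 0 := not_not.1 (h hγ)
    rw [h0, zero_smul]
  obtain ⟨γ, hγ, hmin⟩ := Finset.exists_min_image _
    (fun γ : Root P => cycDist N (P.block γ.1.1) (P.block γ.1.2)) hne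
  simp only [Finset.mem_filter, Finset.mem_univ, true_and] at hγ hmin
  refine ⟨γ, hγ, fun l m hlm => ?_⟩
  have hb : P.block l ≠ P.block m := fun e => hlm (X.2.1 l m e)
  rcases root_or_prime (P := P) l m hb with h | h | ⟨ht, rfl⟩
  · exact hmin ⟨(l, m), h, hb⟩ hlm
  · have hb' : P.block (-m) ≠ P.block (-l) := by rw [P.symm, P.symm]; omega
    have := hmin ⟨(-m, -l), h, hb'⟩ ((lieU_entry_ne_zero_iff X l m).2 hlm)
    simpa only [P.symm, cycDist_neg] using this
  · exact absurd (lieU_antidiagonal_eq_zero h2 ht X l) hlm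

theorem isRoot_neg (ht : t = Series.C) {i : Idx t n} (hb : P.block i ≠ P.block (-i)) :
    IsRoot i (-i) := by
  rcases root_or_prime (P := P) i (-i) hb with h | h | h
  · exact h
  · rwa [neg_neg] at h
  · exact absurd ht h.1

/-- In the symplectic case, an antidiagonal entry can be cleared by a pivot of minimal distance. -/
theorem exists_conj_kill (h2 : (2 : F) ≠ 0) {N : ℤ} (hN : 0 < N)
    (hb : ∀ i j, P.block i - P.block j < N) (ht : t = Series.C) {A : Finset (Idx t n)}
    {X : lieU P F} (hX : RowsIn A (X : Contracted P F)) {i j : Idx t n}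
    (hs : (X : Contracted P F) i j ≠ 0)
    (hmin : SupportedFrom N (cycDist N (P.block i) (P.block j)) (X : Contracted P F))
    (hij : P.block i ≠ -P.block j) :
    ∃ g : (Contracted P F)ˣ, ActsOn A g ∧
      RowsIn A (conj (g : Contracted P F) X : Contracted P F) ∧
      (conj (g : Contracted P F) X : Contracted P F) i j = (X : Contracted P F) i j ∧
      (conj (g : Contracted P F) X : Contracted P F) i (-i) = (X : Contracted P F) i (-i) ∧
      (conj (g : Contracted P F) X : Contracted P F) (-j) j = 0 := by
  have hne : i ≠ -j := fun e => hij (by rw [e, P.symm])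
  obtain ⟨g, hg, hgr, hgs, hgi, hgj⟩ := exists_conj_add_row ht hX hne hs
    -- This coefficient cancels the entry at `(-j, j)`, which changes by `2 c X i j`.
    (-(X : Contracted P F) (-j) j / (2 * (X : Contracted P F) i j)) (by
      intro h
      have hXj : (X : Contracted P F) (-j) j ≠ 0 := fun e => h (by simp [e])
      exact composable_of_cycDist_le (hb _ _) (hmin _ _ hXj)) (by
      intro hc
      -- If `X i (-i)` were nonzero, composability would give `d(-j, i) + d(i, -i) = d(-j, -i) =
      -- d(i, j)`, while minimality gives `d(i, -i) ≥ d(i, j)`. Then `-j` and `i` would lie in the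
      -- same block, against `hij`.
      by_contra h
      have hd := hmin _ _ h
      rw [P.symm, P.symm] at hc
      rw [P.symm] at hd
      rw [composable_iff hN.ne', cycDist_neg] at hc
      have hb1 := hb i j
      have hb2 := hb j i
      have hb3 := hb i (-j)
      have hb4 := hb (-j) i
      rw [P.symm] at hb3 hb4
      unfold cycDist at hc hd
      split_ifs at hc hd <;> omega)
  refine ⟨g, hg, hgr, hgs, hgi, hgj.trans ?_⟩
  field_simp
  ring

/-- Transformation to an element with a pivot that can be cleared. -/
theorem exists_conj_pivot (h2 : (2 : F) ≠ 0) {N : ℤ} (hN : 0 < N)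
    (hb : ∀ i j, P.block i - P.block j < N) {A : Finset (Idx t n)} {X : lieU P F} (hX0 : X ≠ 0)
    (hX : RowsIn A (X : Contracted P F)) :
    ∃ g : (Contracted P F)ˣ, ∃ γ : Root P, ActsOn A g ∧
      RowsIn A (conj (g : Contracted P F) X : Contracted P F) ∧
      (conj (g : Contracted P F) X : Contracted P F) γ.1.1 γ.1.2 ≠ 0 ∧
      SupportedFrom N (cycDist N (P.block γ.1.1) (P.block γ.1.2))
        (conj (g : Contracted P F) X : Contracted P F) ∧
      (γ.1.1 ≠ -γ.1.2 →
        (conj (g : Contracted P F) X : Contracted P F) (-γ.1.2) γ.1.2 = 0 ∧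
        (conj (g : Contracted P F) X : Contracted P F) γ.1.1 (-γ.1.1) = 0) ∧
      (t = Series.C → P.block γ.1.1 = -P.block γ.1.2 → IsAntidiagonal γ) := by
  obtain ⟨⟨⟨i, j⟩, hroot, hbl⟩, hs, hmin⟩ := exists_minimal_root h2 N hX0
  simp only at hs hmin hroot hbl
  have h1 : ActsOn A (1 : (Contracted P F)ˣ) := fun Z _ => by rw [Units.val_one, one_mul]
  by_cases ht : t = Series.C
  swap
  · refine ⟨1, ⟨(i, j), hroot, hbl⟩, h1, ?_⟩
    rw [Units.val_one, conj_one]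
    refine ⟨hX, hs, hmin, fun _ => ⟨?_, lieU_antidiagonal_eq_zero h2 ht X i⟩, fun h => absurd h ht⟩
    have := lieU_antidiagonal_eq_zero h2 ht X (-j)
    rwa [neg_neg] at this
  by_cases hij : P.block i = -P.block j
  · have hbi : P.block i ≠ P.block (-i) := by rw [P.symm]; omega
    have hbj : P.block (-j) ≠ P.block (- -j) := by rw [neg_neg, P.symm]; omega
    by_cases hXi : (X : Contracted P F) i (-i) = 0
    swap
    · refine ⟨1, ⟨(i, -i), isRoot_neg ht hbi, hbi⟩, h1, ?_⟩
      rw [Units.val_one, conj_one]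
      refine ⟨hX, hXi, ?_, fun h => absurd (neg_neg i).symm h, fun _ _ => rfl⟩
      simp only [P.symm]
      rwa [(by omega : -P.block i = P.block j)]
    have hminj : ∀ Y : lieU P F,
        SupportedFrom N (cycDist N (P.block i) (P.block j)) (Y : Contracted P F) →
        SupportedFrom N (cycDist N (P.block (-j)) (P.block (- -j))) (Y : Contracted P F) := by
      intro Y hY
      simp only [neg_neg, P.symm]
      rwa [← hij]
    by_cases hXj : (X : Contracted P F) (-j) j = 0
    swap
    · refine ⟨1, ⟨(-j, - -j), isRoot_neg ht hbj, hbj⟩, h1, ?_⟩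
      rw [Units.val_one, conj_one]
      refine ⟨hX, ?_, hminj X hmin, fun h => absurd (by simp) h, fun _ _ => rfl⟩
      simpa only [neg_neg] using hXj
    have hne : i ≠ -j := fun e => hs (by rw [← hXi, e, neg_neg])
    -- Both antidiagonal entries vanish; adding row `i` to row `-j` creates the nonzero entry `2 X i
    -- j` at `(-j, j)`.
    obtain ⟨g, hg, hgr, -, -, hgj⟩ := exists_conj_add_row ht hX hne hs 1
      (fun _ => by rw [P.symm, hij]; unfold Composable; omega) (fun _ => hXi)
    refine ⟨g, ⟨(-j, - -j), isRoot_neg ht hbj, hbj⟩, hg, hgr, ?_, hminj _ (hmin.conj hN hb _),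
      fun h => absurd (by simp) h, fun _ _ => rfl⟩
    simp only [neg_neg]
    rw [hgj, hXj, zero_add, mul_one]
    exact mul_ne_zero h2 hs
  · have hne : i ≠ -j := fun e => hij (by rw [e, P.symm])
    obtain ⟨g, hg, hgr, hgs, -, hgj⟩ := exists_conj_kill h2 hN hb ht hX hs hmin hij
    have hmin' := hmin.conj hN hb (g : Contracted P F)
    -- The mirror pivot `(-j, -i)` kills the entry at `(i, -i)` without disturbing the zero already
    -- obtained at `(-j, j)`.
    obtain ⟨k, hk, hkr, hks, hkj, hki⟩ := exists_conj_kill h2 hN hb ht hgr (i := -j) (j := -i)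
      ((lieU_entry_ne_zero_iff _ i j).2 (by rwa [hgs]))
      (by rwa [P.symm, P.symm, cycDist_neg]) (by rw [P.symm, P.symm]; omega)
    rw [← conj_mul, ← Units.val_mul] at hkr hks hkj hki
    rw [neg_neg] at hkj hki
    refine ⟨k * g, ⟨(i, j), hroot, hbl⟩, hk.mul hg, hkr, ?_, hmin.conj hN hb _,
      fun _ => ⟨hkj.trans hgj, hki⟩, fun _ h => absurd h hij⟩
    rw [← lieU_entry_ne_zero_iff, hks, lieU_entry_ne_zero_iff, hgs]
    exact hs

/-! ### Monomial representatives of orbits -/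

theorem positions_row {D : Finset (Root P)} {A : Finset (Idx t n)}
    (h : ∀ γ ∈ D, γ.1.1 ∈ A ∧ -γ.1.2 ∈ A) {p : Idx t n × Idx t n} (hp : p ∈ positions D) :
    p.1 ∈ A ∧ -p.2 ∈ A := by
  obtain ⟨γ, hγ, rfl | rfl⟩ := hp
  · exact h γ hγ
  · simpa [prime, and_comm] using h γ hγ

theorem rootVector_rows {A : Finset (Idx t n)} {γ : Root P} (h1 : γ.1.1 ∉ A) (h2 : -γ.1.2 ∉ A)
    (i j : Idx t n) (hi : i ∈ A) : (rootVector F γ : Contracted P F) i j = 0 := by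
  refine rootVector_entry_eq_zero ?_ ?_
  · rintro e
    have e1 : i = γ.1.1 := congrArg Prod.fst e
    exact h1 (e1 ▸ hi)
  · rintro e
    have e1 : i = -γ.1.2 := congrArg Prod.fst e
    exact h2 (e1 ▸ hi)

-- The rows of `D ∪ D'` lie in `A` and its columns in `-A`, so a root using only labels outside `A`
-- cannot conflict with it.
open Classical in
theorem isRookPlacement_insert {D : Finset (Root P)} {A : Finset (Idx t n)} (hD : IsRookPlacement D)
    (h : ∀ γ ∈ D, γ.1.1 ∈ A ∧ -γ.1.2 ∈ A) {γ : Root P} (h1 : γ.1.1 ∉ A) (h2 : -γ.1.2 ∉ A) :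
    IsRookPlacement (insert γ D) := by
  have hpos : ∀ p ∈ positions (insert γ D), (p = γ.1 ∨ p = prime γ.1) ∨ p ∈ positions D := by
    rintro p ⟨γ', hγ', hp⟩
    rcases Finset.mem_insert.1 hγ' with rfl | hγ'
    · exact Or.inl hp
    · exact Or.inr ⟨γ', hγ', hp⟩
  have hout : ∀ p, (p = γ.1 ∨ p = prime γ.1) → p.1 ∉ A ∧ -p.2 ∉ A := by
    rintro p (rfl | rfl)
    · exact ⟨h1, h2⟩
    · simp [prime, h1, h2]
  have hsame : (γ.1.1 = (prime γ.1).1 ∨ γ.1.2 = (prime γ.1).2) → γ.1 = prime γ.1 := by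
    rintro (e | e)
    · refine Prod.ext e ?_
      change γ.1.2 = -γ.1.1
      rw [e]; simp [prime]
    · refine Prod.ext ?_ e
      change γ.1.1 = -γ.1.2
      rw [e]; simp [prime]
  intro p hp q hq hpq
  rcases hpos p hp with hp | hp <;> rcases hpos q hq with hq | hq
  · rcases hp with rfl | rfl <;> rcases hq with rfl | rfl
    · rfl
    · exact hsame hpq
    · exact (hsame (hpq.imp Eq.symm Eq.symm)).symm
    · rfl
  · have a := hout p hp
    have b := positions_row h hq
    rcases hpq with e | e
    · exact absurd (e ▸ b.1) a.1
    · exact absurd (e ▸ b.2) a.2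
  · have a := hout q hq
    have b := positions_row h hp
    rcases hpq with e | e
    · exact absurd (e ▸ b.1) a.1
    · exact absurd (e ▸ b.2) a.2
  · exact hD p hp q hq hpq

/-- Elimination by induction on the set `A` of nonzero rows. Recording that `g` acts only through
labels in `A` is what keeps the earlier root vectors intact. -/
theorem exists_conj_monomial (h2 : (2 : F) ≠ 0) (A : Finset (Idx t n)) :
    ∀ X : lieU P F, RowsIn A (X : Contracted P F) →
    ∃ (g : (Contracted P F)ˣ) (D : Finset (Root P)) (φ : Root P → F), ActsOn A g ∧
      conj (g : Contracted P F) X = ∑ γ ∈ D, φ γ • rootVector F γ ∧ (∀ γ ∈ D, φ γ ≠ 0) ∧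
      (∀ γ ∈ D, γ.1.1 ∈ A ∧ -γ.1.2 ∈ A) ∧ IsRookPlacement D ∧
      (t = Series.C → ∀ γ ∈ D, P.block γ.1.1 = -P.block γ.1.2 → IsAntidiagonal γ) := by
  classical
  obtain ⟨N, hN, hb⟩ := exists_block_bound P
  induction A using Finset.strongInduction with
  | H A ih =>
    intro X hX
    by_cases hX0 : X = 0
    · refine ⟨1, ∅, 0, fun Z _ => by rw [Units.val_one, one_mul], ?_, by simp, by simp, ?_, by simp⟩
      · rw [hX0]; simp
      · rintro p ⟨γ, hγ, -⟩; simp at hγ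
    obtain ⟨g, γ, hg, hgr, hgs, hgm, hg0, hgC⟩ := exists_conj_pivot h2 hN hb hX0 hX
    obtain ⟨k, hk, hkr, hks, hkj, hki⟩ := exists_conj_clear hgr hgs
      (fun l hl => composable_of_cycDist_le (hb _ _) (hgm _ _ hl))
      (fun l hl => composable_of_cycDist_le (hb _ _) (by
        rw [P.symm γ.1.2, P.symm γ.1.1, cycDist_neg, ← P.symm]; exact hgm _ _ hl)) hg0
    rw [← conj_mul, ← Units.val_mul] at hkr hks hkj hki
    set Y := conj ((k * g : (Contracted P F)ˣ) : Contracted P F) X with hY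
    have hs : (Y : Contracted P F) γ.1.1 γ.1.2 ≠ 0 := by rwa [hks]
    have hZ := rowsIn_sub_smul_rootVector hkr γ hs hkj hki
    set s := (Y : Contracted P F) γ.1.1 γ.1.2 with hs_def
    have hiA : γ.1.1 ∈ A := by by_contra h; exact hs (hkr _ _ h)
    have hjA : -γ.1.2 ∈ A := by
      by_contra h; exact (lieU_entry_ne_zero_iff Y _ _).2 hs (hkr _ _ h)
    have hsub : A \ {γ.1.1, -γ.1.2} ⊂ A := by
      refine Finset.ssubset_iff_subset_ne.2 ⟨Finset.sdiff_subset, fun e => ?_⟩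
      rw [← e] at hiA
      simp at hiA
    obtain ⟨m, D, φ, hm, hmX, hφ, hD, hrook, hC⟩ := ih _ hsub _ hZ
    have hγi : γ.1.1 ∉ A \ {γ.1.1, -γ.1.2} := by simp
    have hγj : -γ.1.2 ∉ A \ {γ.1.1, -γ.1.2} := by simp
    have hγD : γ ∉ D := fun h => hγi (hD γ h).1
    refine ⟨m * (k * g), insert γ D, Function.update φ γ s,
      (hm.mono hsub.subset).mul (hk.mul hg), ?_, ?_, ?_,
      isRookPlacement_insert hrook hD hγi hγj, ?_⟩
    · have e : Y = (Y - s • rootVector F γ) + s • rootVector F γ := by abel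
      rw [Units.val_mul, conj_mul, ← hY, e, map_add, hmX, map_smul,
        hm.conj_eq _ (rootVector_rows hγi hγj), Finset.sum_insert hγD, Function.update_self,
        add_comm]
      refine congrArg _ (Finset.sum_congr rfl fun γ' h => ?_)
      rw [Function.update_of_ne (by rintro rfl; exact hγD h)]
    · intro γ' h
      rcases Finset.mem_insert.1 h with rfl | h
      · rwa [Function.update_self]
      · rw [Function.update_of_ne (by rintro rfl; exact hγD ‹_›)]
        exact hφ γ' h
    · intro γ' h
      rcases Finset.mem_insert.1 h with rfl | h
      · exact ⟨hiA, hjA⟩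
      · exact ⟨hsub.subset (hD γ' h).1, hsub.subset (hD γ' h).2⟩
    · intro ht γ' h
      rcases Finset.mem_insert.1 h with rfl | h
      · exact hgC ht
      · exact hC ht γ' h

/-! ### Normalization of the coefficients -/

/-- The diagonal matrix with diagonal entries `c i`. -/
def diagMatrix (P : SymPartition t n) (c : Idx t n → F) : Contracted P F :=
  fun i j => if i = j then c i else 0

theorem diagMatrix_mul_entry (c : Idx t n → F) (X : Contracted P F) (i j : Idx t n) :
    (diagMatrix P c * X) i j = c i * X i j := by
  rw [mul_entry, Finset.sum_eq_single i]
  · rw [if_pos (by unfold Composable; omega), diagMatrix, if_pos rfl]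
  · intro k _ hk
    rw [diagMatrix, if_neg hk.symm]; simp
  · simp

theorem diagMatrix_mul_eq_one {a b : Idx t n → F} (h : ∀ i, a i * b i = 1) :
    diagMatrix P a * diagMatrix P b = 1 := by
  ext i k
  rw [diagMatrix_mul_entry, diagMatrix, one_entry]
  split_ifs
  · exact h i
  · exact mul_zero _

/-- The invertible diagonal matrix with diagonal entries `c i`. -/
def diagUnit (P : SymPartition t n) (c : Idx t n → Fˣ) : (Contracted P F)ˣ where
  val := diagMatrix P fun i => c i
  inv := diagMatrix P fun i => ((c i)⁻¹ : Fˣ)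
  val_inv := diagMatrix_mul_eq_one fun i => (c i).mul_inv
  inv_val := diagMatrix_mul_eq_one fun i => (c i).inv_mul

theorem diagUnit_mul_entry (c : Idx t n → Fˣ) (X : Contracted P F) (i j : Idx t n) :
    ((diagUnit P c : Contracted P F) * X) i j = c i * X i j :=
  diagMatrix_mul_entry _ X i j

theorem conj_diagUnit_entry (c : Idx t n → Fˣ) (X : lieU P F) (i j : Idx t n) :
    (conj (diagUnit P c : Contracted P F) X : Contracted P F) i j =
      c i * c (-j) * (X : Contracted P F) i j := by
  have h : (X : Contracted P F) * dag (diagUnit P c : Contracted P F) =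
      -dag ((diagUnit P c : Contracted P F) * (X : Contracted P F)) := by
    rw [dag_mul, X.2.2, neg_mul, neg_neg]
  rw [conj_coe, mul_assoc, diagUnit_mul_entry, h, neg_entry, dag_entry, diagUnit_mul_entry]
  linear_combination (-(c i * c (-j) : F)) * lieU_entry X i j

theorem conj_diagUnit_rootVector (c : Idx t n → Fˣ) (γ : Root P) :
    conj (diagUnit P c : Contracted P F) (rootVector F γ) =
      (c γ.1.1 * c (-γ.1.2) : F) • rootVector F γ := by
  refine Subtype.ext (Contracted.ext fun i j => ?_)
  rw [conj_diagUnit_entry, Submodule.coe_smul, smul_entry]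
  by_cases h : (i, j) = γ.1
  · rw [← h]
  by_cases h' : (i, j) = prime γ.1
  · have h1 : i = -γ.1.2 := congrArg Prod.fst h'
    have h2 : j = -γ.1.1 := congrArg Prod.snd h'
    rw [h1, h2, neg_neg, mul_comm (c (-γ.1.2) : F)]
  · rw [rootVector_entry_eq_zero h h', mul_zero, mul_zero]

theorem eq_of_row_eq {D : Finset (Root P)} (hD : IsRookPlacement D) {γ γ' : Root P} (h : γ ∈ D)
    (h' : γ' ∈ D) (e : γ.1.1 = γ'.1.1) : γ = γ' :=
  Subtype.ext (hD _ ⟨γ, h, Or.inl rfl⟩ _ ⟨γ', h', Or.inl rfl⟩ (Or.inl e))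

theorem isAntidiagonal_of_row_eq {D : Finset (Root P)} (hD : IsRookPlacement D) {γ γ' : Root P}
    (h : γ ∈ D) (h' : γ' ∈ D) (e : γ'.1.1 = -γ.1.2) : γ = γ' ∧ IsAntidiagonal γ := by
  have e1 : γ'.1 = prime γ.1 := hD _ ⟨γ', h', Or.inl rfl⟩ _ ⟨γ, h, Or.inr rfl⟩ (Or.inl e)
  have e2 := prime_eq_of_root γ γ' e1.symm
  subst e2
  exact ⟨rfl, (prime_eq_iff _).1 e1.symm⟩

-- A rook placement allows its coefficients to be scaled independently, but on the antidiagonal the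
-- row and column factors coincide and only squares are available.
open Classical in
theorem exists_conj_scale {D : Finset (Root P)} (hD : IsRookPlacement D) (v : Root P → Fˣ) :
    ∃ g : (Contracted P F)ˣ, ∀ γ ∈ D, conj (g : Contracted P F) (rootVector F γ) =
      (if IsAntidiagonal γ then (v γ : F) ^ 2 else v γ) • rootVector F γ := by
  -- The factor `v γ` sits at the row label of `γ`, with `1` elsewhere. The label `-γ.1.2` is not
  -- the row of a root in `D` unless `γ` is antidiagonal, so it carries the default value.
  let c : Idx t n → Fˣ := fun i => if h : ∃ γ ∈ D, γ.1.1 = i then v h.choose else 1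
  have hc : ∀ γ ∈ D, c γ.1.1 = v γ := by
    intro γ hγ
    have h : ∃ γ' ∈ D, γ'.1.1 = γ.1.1 := ⟨γ, hγ, rfl⟩
    simp only [c]
    rw [dif_pos h, eq_of_row_eq hD h.choose_spec.1 hγ h.choose_spec.2]
  refine ⟨diagUnit P c, fun γ hγ => ?_⟩
  rw [conj_diagUnit_rootVector, hc γ hγ]
  congr 1
  split_ifs with h
  · have e : -γ.1.2 = γ.1.1 := by rw [h, neg_neg]
    rw [e, hc γ hγ, sq]
  · have e : c (-γ.1.2) = 1 :=
      dif_neg fun ⟨γ', h1, h2⟩ => h (isAntidiagonal_of_row_eq hD hγ h1 h2).2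
    rw [e, Units.val_one, mul_one]

/-! ### Rotations of two labels, squares and sums of two squares -/

theorem unitMatrix_apply (a b l m : Idx t n) :
    unitMatrix P F (a, b) l m = if l = a ∧ m = b then 1 else 0 :=
  if_congr Prod.mk_inj rfl rfl

theorem unitMatrix_mul_unitMatrix (a b c d : Idx t n) :
    unitMatrix P F (a, b) * unitMatrix P F (c, d) =
      if b = c ∧ Composable (P.block a) (P.block b) (P.block d) then unitMatrix P F (a, d)
      else 0 := by
  ext l m
  have h := smul_unitMatrix_mul_entry (1 : F) a b (unitMatrix P F (c, d)) l m
  rw [one_smul] at h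
  rw [h]
  by_cases hm : m = d
  · subst hm
    split_ifs with h1 h2 h2 <;> simp [unitMatrix_apply] <;> grind
  · split_ifs <;> simp [unitMatrix_apply, hm]

/-- The rotation of two labels. -/
def rotation (P : SymPartition t n) (i k : Idx t n) (a b : F) : Contracted P F :=
  1 + (a - 1) • (unitMatrix P F (i, i) + unitMatrix P F (k, k)) +
    b • (unitMatrix P F (i, k) - unitMatrix P F (k, i))

theorem composable_of_eq {a b c : ℤ} (h : a = b) : Composable a b c := by
  unfold Composable; omega

/-- Within one block, rotations multiply like the numbers `a + b √-1`. -/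
theorem rotation_mul {i k : Idx t n} (hik : i ≠ k) (hb : P.block i = P.block k) (a b a' b' : F) :
    rotation P i k a b * rotation P i k a' b' =
      rotation P i k (a * a' - b * b') (a * b' + b * a') := by
  have e : (unitMatrix P F (i, i) + unitMatrix P F (k, k)) *
      (unitMatrix P F (i, i) + unitMatrix P F (k, k)) =
      unitMatrix P F (i, i) + unitMatrix P F (k, k) := by
    simp [mul_add, add_mul, unitMatrix_mul_unitMatrix, hik, hik.symm, composable_of_eq]
  have e1 : (unitMatrix P F (i, i) + unitMatrix P F (k, k)) *
      (unitMatrix P F (i, k) - unitMatrix P F (k, i)) =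
      unitMatrix P F (i, k) - unitMatrix P F (k, i) := by
    simp [mul_sub, add_mul, unitMatrix_mul_unitMatrix, hik, hik.symm, composable_of_eq]
  have e2 : (unitMatrix P F (i, k) - unitMatrix P F (k, i)) *
      (unitMatrix P F (i, i) + unitMatrix P F (k, k)) =
      unitMatrix P F (i, k) - unitMatrix P F (k, i) := by
    simp [mul_add, sub_mul, unitMatrix_mul_unitMatrix, hik, hik.symm, composable_of_eq, hb]
    abel
  have e3 : (unitMatrix P F (i, k) - unitMatrix P F (k, i)) *
      (unitMatrix P F (i, k) - unitMatrix P F (k, i)) =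
      -(unitMatrix P F (i, i) + unitMatrix P F (k, k)) := by
    simp [mul_sub, sub_mul, unitMatrix_mul_unitMatrix, hik, hik.symm, composable_of_eq, hb]
    abel
  unfold rotation
  generalize unitMatrix P F (i, i) + unitMatrix P F (k, k) = E at *
  generalize unitMatrix P F (i, k) - unitMatrix P F (k, i) = J at *
  simp only [mul_add, add_mul, smul_mul_assoc, mul_smul_comm, one_mul, mul_one,
    e, e1, e2, e3]
  module

/-- A segment other than `I_0` lies entirely on one side of zero. -/
theorem sign_eq_of_block_eq {i k : Idx t n} (hb : P.block i = P.block k)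
    (hi : P.block i ≠ P.block (-i)) : sign F i = sign F k := by
  rw [P.symm] at hi
  have key : ∀ l : Idx t n, P.block l ≠ -P.block l → ((l : ℤ) < 0 ↔ P.block l < 0) := by
    intro l hl
    constructor
    · intro h
      have := P.mono l (-l) (by rw [coe_neg]; omega)
      rw [P.symm] at this
      omega
    · intro h
      by_contra h'
      have := P.mono (-l) l (by rw [coe_neg]; omega)
      rw [P.symm] at this
      omega
  have h : ((i : ℤ) < 0) ↔ ((k : ℤ) < 0) := by
    rw [key i hi, key k (by rwa [← hb]), hb]
  unfold sign
  simp only [h]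

theorem rootVector_of_isAntidiagonal {γ : Root P} (h : IsAntidiagonal γ) :
    (rootVector F γ : Contracted P F) = unitMatrix P F (γ.1.1, -γ.1.1) := by
  have e : γ.1 = (γ.1.1, -γ.1.1) := Prod.ext rfl h
  rw [← e]
  exact if_pos ((prime_eq_iff _).2 h)

/-- The sum of two antidiagonal root vectors in one block corresponds to the form `x² + y²`, which
the rotation multiplies by its norm `a² + b²`. -/
theorem exists_conj_rotate (ht : t = Series.C) {γ γ' : Root P} (hne : γ ≠ γ')
    (h : IsAntidiagonal γ) (h' : IsAntidiagonal γ') (hb : P.block γ.1.1 = P.block γ'.1.1) {a b : F}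
    (hab : a ^ 2 + b ^ 2 ≠ 0) :
    ∃ g : (Contracted P F)ˣ, ActsOn {γ.1.1, γ'.1.1} g ∧
      conj (g : Contracted P F) (rootVector F γ + rootVector F γ') =
        (a ^ 2 + b ^ 2) • (rootVector F γ + rootVector F γ') := by
  set i := γ.1.1 with hi
  set k := γ'.1.1 with hk
  have hik : i ≠ k := fun e => hne (Subtype.ext (Prod.ext e (by rw [h, h', ← hi, ← hk, e])))
  have hbl : P.block i ≠ P.block (-i) := by
    have := γ.2.2
    rwa [h] at this
  have hsign : sign F i = sign F k := sign_eq_of_block_eq hb hbl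
  have hone : rotation P i k (1 : F) 0 = 1 := by simp [rotation]
  have hinv : a * (a / (a ^ 2 + b ^ 2)) - b * (-b / (a ^ 2 + b ^ 2)) = 1 := by
    field_simp; ring
  have hinv' : a * (-b / (a ^ 2 + b ^ 2)) + b * (a / (a ^ 2 + b ^ 2)) = 0 := by ring
  refine ⟨⟨rotation P i k a b, rotation P i k (a / (a ^ 2 + b ^ 2)) (-b / (a ^ 2 + b ^ 2)), ?_, ?_⟩,
    ?_, ?_⟩
  · rw [rotation_mul hik hb, hinv, hinv', hone]
  · rw [rotation_mul hik hb, ← hone]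
    congr 1
    · linear_combination hinv
    · linear_combination hinv'
  · intro Z hZ
    change rotation P i k a b * Z = Z
    have h0 : ∀ l m, (m = i ∨ m = k) → unitMatrix P F (l, m) * Z = 0 := by
      intro l m hm
      refine mul_eq_zero_of_rows fun l' m' c hc => hZ m' c ?_
      have : m' = m := by
        by_contra hm'
        exact hc (by simp [unitMatrix, hm'])
      subst this
      simpa using hm
    simp [rotation, add_mul, sub_mul, h0]
  · refine Subtype.ext ?_
    have hS : ((rootVector F γ + rootVector F γ' : lieU P F) : Contracted P F) =
        unitMatrix P F (i, -i) + unitMatrix P F (k, -k) := by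
      rw [Submodule.coe_add, rootVector_of_isAntidiagonal h, rootVector_of_isAntidiagonal h']
    have hdS := (rootVector F γ + rootVector F γ' : lieU P F).2.2
    rw [conj_coe, Submodule.coe_smul]
    change rotation P i k a b * _ * dag (rotation P i k a b) = _
    rw [hS] at hdS ⊢
    -- With `S` the sum of the two vectors and `T` the skew combination, `E` fixes both while `J`
    -- sends `S` to `T` and `T` to `-S`. Applying the antiautomorphism gives the corresponding right
    -- multiplications.
    have e1 : (unitMatrix P F (i, i) + unitMatrix P F (k, k)) *
        (unitMatrix P F (i, -i) + unitMatrix P F (k, -k)) =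
        unitMatrix P F (i, -i) + unitMatrix P F (k, -k) := by
      simp [mul_add, add_mul, unitMatrix_mul_unitMatrix, hik, hik.symm, composable_of_eq]
    have e2 : (unitMatrix P F (i, k) - unitMatrix P F (k, i)) *
        (unitMatrix P F (i, -i) + unitMatrix P F (k, -k)) =
        unitMatrix P F (i, -k) - unitMatrix P F (k, -i) := by
      simp [mul_add, sub_mul, unitMatrix_mul_unitMatrix, hik, hik.symm, composable_of_eq, hb]
      abel
    have e3 : (unitMatrix P F (i, i) + unitMatrix P F (k, k)) *
        (unitMatrix P F (i, -k) - unitMatrix P F (k, -i)) =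
        unitMatrix P F (i, -k) - unitMatrix P F (k, -i) := by
      simp [mul_sub, add_mul, unitMatrix_mul_unitMatrix, hik, hik.symm, composable_of_eq]
    have e4 : (unitMatrix P F (i, k) - unitMatrix P F (k, i)) *
        (unitMatrix P F (i, -k) - unitMatrix P F (k, -i)) =
        -(unitMatrix P F (i, -i) + unitMatrix P F (k, -k)) := by
      simp [mul_sub, sub_mul, unitMatrix_mul_unitMatrix, hik, hik.symm, composable_of_eq, hb]
      abel
    have hdT : dag (unitMatrix P F (i, -k) - unitMatrix P F (k, -i)) =
        unitMatrix P F (i, -k) - unitMatrix P F (k, -i) := by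
      have s1 : sign F i * sign F (-k) = -1 := by
        rw [hsign, sign_mul_sign_neg, if_pos ht]
      have s2 : sign F k * sign F (-i) = -1 := by
        rw [← hsign, sign_mul_sign_neg, if_pos ht]
      simp only [dag_sub, dag_unitMatrix, s1, s2, prime, neg_neg, neg_smul, one_smul]
      abel
    unfold rotation
    generalize unitMatrix P F (i, i) + unitMatrix P F (k, k) = E at *
    generalize unitMatrix P F (i, k) - unitMatrix P F (k, i) = J at *
    generalize unitMatrix P F (i, -i) + unitMatrix P F (k, -k) = S at *
    generalize unitMatrix P F (i, -k) - unitMatrix P F (k, -i) = T at *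
    have f1 : S * dag E = S := by
      have := congrArg dag e1
      rwa [dag_mul, hdS, neg_mul, neg_inj] at this
    have f2 : S * dag J = -T := by
      have := congrArg dag e2
      rwa [dag_mul, hdS, hdT, neg_mul, neg_eq_iff_eq_neg] at this
    have f3 : T * dag E = T := by
      have := congrArg dag e3
      rwa [dag_mul, hdT] at this
    have f4 : T * dag J = S := by
      have := congrArg dag e4
      rwa [dag_mul, hdT, dag_neg, hdS, neg_neg] at this
    simp only [dag_add, dag_one, dag_smul, mul_add, add_mul, smul_mul_assoc, mul_smul_comm,
      one_mul, mul_one, e1, e2, f1, f2, f3, f4]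
    module

/-- In a finite field the product of two nonsquares is a square, so `1` and `δ` represent all square
classes. -/
theorem exists_sq_mul_eq [Finite F] {δ : Fˣ} (hδ : ¬ IsSquare δ) (x : Fˣ) :
    ∃ r : Fˣ, r ^ 2 * x = 1 ∨ r ^ 2 * x = δ := by
  classical
  have := Fintype.ofFinite F
  have hu : ∀ y : Fˣ, IsSquare (y : F) → ∃ z : Fˣ, y = z ^ 2 := by
    rintro y ⟨z, hz⟩
    have hz0 : z ≠ 0 := by rintro rfl; exact y.ne_zero (by rw [hz, mul_zero])
    exact ⟨Units.mk0 z hz0, Units.ext (by simp [hz, sq])⟩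
  by_cases hx : IsSquare (x : F)
  · obtain ⟨z, rfl⟩ := hu x hx
    exact ⟨z⁻¹, Or.inl (by rw [← mul_pow, inv_mul_cancel, one_pow])⟩
  · have hδ' : ¬ IsSquare (δ : F) := fun h => by
      obtain ⟨z, hz⟩ := hu δ h
      exact hδ ⟨z, by rw [hz, sq]⟩
    have h1 : quadraticChar F ((x * δ : Fˣ) : F) = 1 := by
      rw [Units.val_mul, map_mul, quadraticChar_neg_one_iff_not_isSquare.2 hx,
        quadraticChar_neg_one_iff_not_isSquare.2 hδ']
      norm_num
    obtain ⟨z, hz⟩ := hu _ ((quadraticChar_one_iff_isSquare (Units.ne_zero _)).1 h1)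
    refine ⟨δ * z⁻¹, Or.inr ?_⟩
    rw [mul_pow, inv_pow, ← hz, mul_inv, mul_right_comm, sq]
    group

theorem exists_sq_add_sq_eq [Finite F] (h2 : (2 : F) ≠ 0) (x : F) :
    ∃ a b : F, a ^ 2 + b ^ 2 = x := by
  have := Fintype.ofFinite F
  open Polynomial in
  obtain ⟨a, b, hab⟩ := FiniteField.exists_root_sum_quadratic (R := F) (f := X ^ 2)
    (g := X ^ 2 - C x) (degree_X_pow 2) (degree_X_pow_sub_C (by decide) _)
    (FiniteField.odd_card_of_char_ne_two fun h => h2 (by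
      have := CharP.cast_eq_zero F (ringChar F)
      rw [h] at this
      exact_mod_cast this))
  refine ⟨a, b, ?_⟩
  rw [← sub_eq_zero]
  simpa [← add_sub_assoc] using hab

/-! ### Normalized representatives and basic pairs -/

theorem series_eq_of_isAntidiagonal {γ : Root P} (h : IsAntidiagonal γ) : t = Series.C := by
  by_contra ht
  have hr := γ.2.1
  rw [h] at hr
  simp only [IsRoot, IsPosRoot, coe_neg, abs_neg, ht, false_and, or_false] at hr
  have h1 := le_abs_self (γ.1.1 : ℤ)
  have h3 := neg_le_abs (γ.1.1 : ℤ)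
  omega

/-- A representative `∑ w(γ) ψ(γ) 𝓔_γ` of an orbit, with normalized values of `ψ`. -/
def IsNormalized (δ : Fˣ) (w : Root P → F) (D : Finset (Root P)) (X : lieU P F)
    (ψ : Root P → Fˣ) : Prop :=
  (∀ γ, ψ γ = 1 ∨ ψ γ = δ) ∧ (∀ γ, ψ γ = δ → IsAntidiagonal γ) ∧
    ∃ g : (Contracted P F)ˣ,
      conj (g : Contracted P F) X = ∑ γ ∈ D, (w γ * ψ γ : F) • rootVector F γ

/-- Off the antidiagonal a coefficient can be given any nonzero value, here `w γ`; on it, a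
coefficient is determined up to squares. The weight `w` lets one argument serve both for vectors and
for linear forms. -/
theorem exists_isNormalized [Finite F] {δ : Fˣ} (hδ : ¬ IsSquare δ)
    {w : Root P → F} (hw0 : ∀ γ, w γ ≠ 0) (hw : ∀ γ, IsAntidiagonal γ → w γ = 1)
    {D : Finset (Root P)} (hD : IsRookPlacement D) {φ : Root P → F} (hφ : ∀ γ ∈ D, φ γ ≠ 0)
    {X : lieU P F} {g : (Contracted P F)ˣ}
    (hX : conj (g : Contracted P F) X = ∑ γ ∈ D, φ γ • rootVector F γ) :
    ∃ ψ, IsNormalized δ w D X ψ := by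
  classical
  have hδ1 : δ ≠ 1 := fun e => hδ (e ▸ IsSquare.one)
  have key : ∀ γ : Root P, ∃ v ψ : Fˣ, (ψ = 1 ∨ ψ = δ) ∧ (ψ = δ → IsAntidiagonal γ) ∧
      (γ ∈ D → φ γ * (if IsAntidiagonal γ then (v : F) ^ 2 else v) = w γ * ψ) := by
    intro γ
    by_cases hγ : γ ∈ D
    swap
    · exact ⟨1, 1, Or.inl rfl, fun e => absurd e.symm hδ1, fun h => absurd h hγ⟩
    by_cases ha : IsAntidiagonal γ
    · obtain ⟨r, hr⟩ := exists_sq_mul_eq hδ (Units.mk0 _ (hφ γ hγ))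
      refine ⟨r, r ^ 2 * Units.mk0 _ (hφ γ hγ), hr, fun _ => ha, fun _ => ?_⟩
      rw [if_pos ha, hw γ ha]
      simp [mul_comm]
    · refine ⟨Units.mk0 _ (div_ne_zero (hw0 γ) (hφ γ hγ)), 1, Or.inl rfl,
        fun e => absurd e.symm hδ1, fun _ => ?_⟩
      rw [if_neg ha, Units.val_mk0, mul_div_cancel₀ _ (hφ γ hγ), Units.val_one, mul_one]
  choose v ψ h1 h3 h4 using key
  obtain ⟨k, hk⟩ := exists_conj_scale hD v
  refine ⟨ψ, h1, h3, k * g, ?_⟩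
  rw [Units.val_mul, conj_mul, hX, map_sum]
  refine Finset.sum_congr rfl fun γ hγ => ?_
  rw [map_smul, hk γ hγ, smul_smul, h4 γ hγ]

/-- Since `δ⁻¹ = a² + b²`, a rotation replaces two coefficients `δ` in the same block by `1`. It
fixes the other root vectors because `D` is a rook placement. -/
theorem exists_isNormalized_merge [Finite F] (h2 : (2 : F) ≠ 0) {δ : Fˣ} (hδ1 : δ ≠ 1)
    {w : Root P → F} (hw : ∀ γ, IsAntidiagonal γ → w γ = 1) {D : Finset (Root P)}
    (hD : IsRookPlacement D) {X : lieU P F} {ψ : Root P → Fˣ} (hψ : IsNormalized δ w D X ψ)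
    {γ γ' : Root P} (hγ : γ ∈ D) (hγ' : γ' ∈ D) (hne : γ ≠ γ')
    (hb : P.block γ.1.1 = P.block γ'.1.1) (h : ψ γ = δ) (h' : ψ γ' = δ) :
    ∃ ψ', IsNormalized δ w D X ψ' ∧ ψ' γ = 1 ∧ ∀ x, ψ' x = δ → ψ x = δ := by
  classical
  obtain ⟨hψ1, hψ2, g, hg⟩ := hψ
  have ha := hψ2 γ h
  have ha' := hψ2 γ' h'
  obtain ⟨a, b, hab⟩ := exists_sq_add_sq_eq h2 ((δ⁻¹ : Fˣ) : F)
  obtain ⟨k, hkA, hk⟩ := exists_conj_rotate (series_eq_of_isAntidiagonal ha) hne ha ha' hb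
    (a := a) (b := b) (by rw [hab]; exact Units.ne_zero _)
  set ψ' : Root P → Fˣ := fun x => if x = γ ∨ x = γ' then 1 else ψ x with hψ'
  have hval : ∀ x, ψ' x = δ → ψ x = δ := by
    intro x hx
    simp only [hψ'] at hx
    split_ifs at hx
    · exact absurd hx.symm hδ1
    · exact hx
  refine ⟨ψ', ⟨?_, fun x hx => hψ2 x (hval x hx), k * g, ?_⟩, by simp [hψ'], hval⟩
  · intro x
    simp only [hψ']
    split_ifs
    · exact Or.inl rfl
    · exact hψ1 x
  have hsplit : ∀ f : Root P → lieU P F, ∑ x ∈ D, f x =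
      (f γ + f γ') + ∑ x ∈ (D.erase γ).erase γ', f x := by
    intro f
    rw [add_assoc, Finset.add_sum_erase _ _ (Finset.mem_erase.2 ⟨hne.symm, hγ'⟩),
      Finset.add_sum_erase _ _ hγ]
  have hrest : ∀ x ∈ (D.erase γ).erase γ', conj (k : Contracted P F)
      ((w x * ψ x : F) • rootVector F x) = (w x * ψ' x : F) • rootVector F x := by
    intro x hx
    simp only [Finset.mem_erase] at hx
    obtain ⟨h1, h3, h4⟩ := hx
    have e : ψ' x = ψ x := if_neg (by tauto)
    rw [map_smul, e]
    congr 1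
    refine hkA.conj_eq _ (rootVector_rows ?_ ?_)
    · simp only [Finset.mem_insert, Finset.mem_singleton, not_or]
      exact ⟨fun e => h3 (eq_of_row_eq hD h4 hγ e), fun e => h1 (eq_of_row_eq hD h4 hγ' e)⟩
    · simp only [Finset.mem_insert, Finset.mem_singleton, not_or]
      exact ⟨fun e => h3 (isAntidiagonal_of_row_eq hD h4 hγ e.symm).1,
        fun e => h1 (isAntidiagonal_of_row_eq hD h4 hγ' e.symm).1⟩
  have e1 : ψ' γ = 1 := if_pos (Or.inl rfl)
  have e2 : ψ' γ' = 1 := if_pos (Or.inr rfl)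
  rw [Units.val_mul, conj_mul, hg, hsplit, map_add, map_sum, Finset.sum_congr rfl hrest,
    hsplit fun x => (w x * ψ' x : F) • rootVector F x, hw γ ha, hw γ' ha', h, h', e1, e2,
    ← smul_add, map_smul, hk, smul_smul, hab]
  simp

theorem exists_basicPair [Finite F] (h2 : (2 : F) ≠ 0) {δ : Fˣ} (hδ : ¬ IsSquare δ)
    {w : Root P → F} (hw0 : ∀ γ, w γ ≠ 0) (hw : ∀ γ, IsAntidiagonal γ → w γ = 1)
    (X : lieU P F) : ∃ (b : BasicPair P δ) (g : (Contracted P F)ˣ),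
      conj (g : Contracted P F) X = ∑ γ : b.D, (w γ.1 * b.φ γ : F) • rootVector F γ.1 := by
  classical
  have hδ1 : δ ≠ 1 := fun e => hδ (e ▸ IsSquare.one)
  obtain ⟨g, D, φ, -, hX, hφ, -, hD, hC⟩ :=
    exists_conj_monomial h2 Finset.univ X (fun i _ h => absurd (Finset.mem_univ i) h)
  have hex := exists_isNormalized hδ hw0 hw hD hφ hX
  -- A normalization with the fewest values `δ` admits no further merging, which gives the last
  -- condition on a basic pair.
  obtain ⟨ψ, hψ, hmin⟩ : ∃ ψ, IsNormalized δ w D X ψ ∧ ∀ ψ', IsNormalized δ w D X ψ' →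
      (D.filter fun γ => ψ γ = δ).card ≤ (D.filter fun γ => ψ' γ = δ).card := by
    obtain ⟨ψ, hψ⟩ := exists_minimalFor_of_wellFoundedLT (IsNormalized δ w D X)
      (fun ψ => (D.filter fun γ => ψ γ = δ).card) hex
    exact ⟨ψ, hψ.1, fun ψ' h => (le_total _ _).elim id (hψ.2 h)⟩
  have hmerge : ∀ γ ∈ D, ∀ γ' ∈ D, P.block γ.1.1 = P.block γ'.1.1 → ψ γ = δ → ψ γ' = δ →
      γ = γ' := by
    intro γ hγ γ' hγ' hb h h'
    by_contra hne
    obtain ⟨ψ', h1, h3, h4⟩ := exists_isNormalized_merge h2 hδ1 hw hD hψ hγ hγ' hne hb h h'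
    refine absurd (hmin ψ' h1) (not_le.2 (Finset.card_lt_card ?_))
    refine Finset.ssubset_iff_of_subset ?_ |>.2 ⟨γ, by simp [hγ, h], by simp [h3, hδ1.symm]⟩
    intro x hx
    simp only [Finset.mem_filter] at hx ⊢
    exact ⟨hx.1, h4 x hx.2⟩
  obtain ⟨hψ1, hψ2, k, hk⟩ := hψ
  refine ⟨⟨D, fun γ => ψ γ.1, hD, fun ht γ => ?_, fun ht => ⟨fun γ => hψ1 _, fun γ => hψ2 _,
    fun m => ⟨?_, ?_⟩⟩⟩, k, ?_⟩
  · rcases hψ1 γ.1 with h | h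
    · exact h
    · exact absurd (series_eq_of_isAntidiagonal (hψ2 _ h)) ht
  · intro γ h1 h3
    exact hC ht γ.1 γ.2 (by rw [h1, h3, neg_neg])
  · intro γ γ' h1 _ h3 _ h5 h6
    exact Subtype.ext (hmerge _ γ.2 _ γ'.2 (h1.trans h3.symm) h5 h6)
  · rw [hk]
    exact (Finset.sum_coe_sort D fun γ => (w γ * ψ γ : F) • rootVector F γ).symm

/-! ### Basic pairs represent all orbits of vectors and of forms -/

theorem exists_superclass_orbit [Finite F] (h2 : (2 : F) ≠ 0) {δ : Fˣ} (hδ : ¬ IsSquare δ)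
    (X : lieU P F) : ∃ b : BasicPair P δ, orbit b.vector = orbit X := by
  obtain ⟨b, g, hb⟩ := exists_basicPair h2 hδ (w := fun _ => 1) (fun _ => one_ne_zero)
    (fun _ _ => rfl) X
  refine ⟨b, ?_⟩
  simp only [one_mul] at hb
  rw [← orbit_conj g X, hb]
  rfl

/-- The opposite roots of those of a basic pair form a basic pair. -/
theorem exists_swap {δ : Fˣ} (b : BasicPair P δ) : ∃ b' : BasicPair P δ,
    b'.form = ∑ γ : b.D, (b.φ γ : F) • rootCoord F γ.1.swap := by
  classical
  let e : Root P ≃ Root P := ⟨Root.swap, Root.swap, Root.swap_swap, Root.swap_swap⟩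
  let D' := b.D.map e.toEmbedding
  have hmem : ∀ {γ}, γ ∈ D' → γ.swap ∈ b.D := by
    intro γ hγ
    obtain ⟨x, hx, rfl⟩ := Finset.mem_map.1 hγ
    exact hx
  have hpos : ∀ p ∈ positions D', (p.2, p.1) ∈ positions b.D := by
    rintro p ⟨γ, hγ, rfl | rfl⟩
    · exact ⟨γ.swap, hmem hγ, Or.inl rfl⟩
    · exact ⟨γ.swap, hmem hγ, Or.inr rfl⟩
  have hanti : ∀ γ : Root P, IsAntidiagonal γ.swap → IsAntidiagonal γ := by
    intro γ h
    change γ.1.2 = -γ.1.1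
    have h' : γ.1.1 = -γ.1.2 := h
    rw [h', neg_neg]
  refine ⟨⟨D', fun γ => b.φ ⟨γ.1.swap, hmem γ.2⟩, ?_, fun ht γ => b.basic.1 ht _, fun ht => ?_⟩, ?_⟩
  · intro p hp q hq hpq
    have := b.rook _ (hpos p hp) _ (hpos q hq) hpq.symm
    rw [Prod.mk_inj] at this
    exact Prod.ext this.2 this.1
  · obtain ⟨h1, h2, h3⟩ := b.basic.2 ht
    refine ⟨fun γ => h1 _, fun γ h => hanti _ (h2 _ h), fun k => ⟨?_, ?_⟩⟩
    · intro γ hk hk'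
      exact hanti _ ((h3 (-k)).1 ⟨γ.1.swap, hmem γ.2⟩ hk' (by rw [neg_neg]; exact hk))
    · intro γ γ' hk hk' hl hl' hd hd'
      have := (h3 (-k)).2 ⟨γ.1.swap, hmem γ.2⟩ ⟨γ'.1.swap, hmem γ'.2⟩ hk'
        (by rw [neg_neg]; exact hk) hl' (by rw [neg_neg]; exact hl) hd hd'
      exact Subtype.ext (e.injective (congrArg Subtype.val this))
  · refine Fintype.sum_equiv (e.subtypeEquiv fun γ => ⟨fun h => hmem h, fun h => ?_⟩) _ _ ?_
    · exact Finset.mem_map.2 ⟨γ.swap, h, rfl⟩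
    · intro γ; rfl

theorem exists_dualOrbit_eq [Finite F] (h2 : (2 : F) ≠ 0) {δ : Fˣ} (hδ : ¬ IsSquare δ)
    (X : lieU P F) : ∃ b : BasicPair P δ, dualOrbit b.form = toDual '' orbit X := by
  classical
  obtain ⟨b, g, hb⟩ := exists_basicPair h2 hδ
    -- The weights are inverse to the factors in `toDual_rootVector`, so the coefficients of the
    -- resulting linear form are exactly the values of `φ`.
    (w := fun γ => if IsAntidiagonal γ then 1 else (2 : F)⁻¹)
    (fun γ => by split_ifs <;> simp [h2]) (fun γ h => if_pos h) X
  obtain ⟨b', hb'⟩ := exists_swap b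
  refine ⟨b', ?_⟩
  have h : b'.form = toDual (conj (g : Contracted P F) X) := by
    rw [hb, hb', map_sum]
    refine Finset.sum_congr rfl fun γ _ => ?_
    rw [map_smul, toDual_rootVector, smul_smul]
    congr 1
    split_ifs
    · ring
    · field_simp
  rw [h, dualOrbit_toDual, orbit_conj]

/-- Sums over different members are orthogonal, while each sum has nonzero norm, so they cannot
coincide. -/
theorem orbitSum_injOn [Finite F] (h2 : (2 : F) ≠ 0) {ε : AddChar F ℂ} (hε : ε ≠ 1)
    {S : Set (Set (Module.Dual F (lieU P F)))} (hS : S.Pairwise Disjoint)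
    (hne : ∀ O ∈ S, O.Nonempty) : S.InjOn (orbitSum ε) := by
  have := Fintype.ofFinite (groupU P F)
  intro O hO O' hO' h
  by_contra hOO'
  have h1 := sum_orbitSum_mul_eq_zero h2 hε (hS hO hO' hOO')
  rw [← h] at h1
  exact sum_orbitSum_mul_self_ne_zero h2 hε (hne O hO) h1

end

end ParabolicContraction

/-! ### The supercharacter theory -/

open ParabolicContraction in
theorem mainTheorem8 {F : Type*} [Field F] [Finite F] (hF : (2 : F) ≠ 0)
    (ε : AddChar F ℂ) (hε : ε ≠ 1) (δ : Fˣ) (hδ : ¬ IsSquare δ)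
    (t : Series) (n : ℕ) (P : SymPartition t n) :
    IsSupercharacterTheory
      (Set.range fun b : BasicPair P δ => b.sigma ε)
      (Set.range fun b : BasicPair P δ => b.superclass) := by
  classical
  have hfin := Fintype.ofFinite (groupU P F)
  have hsurj := cayley_surjective (P := P) hF
  -- Classes and characters are both rewritten as images of the set of all orbits in `𝔲ᵃ`. Basic
  -- pairs play no part in the axioms after that, apart from the nonemptiness of the classes.
  have hK : (Set.range fun b : BasicPair P δ => b.superclass) =
      (fun O => cayley ⁻¹' O) '' Set.range (orbit : lieU P F → Set (lieU P F)) := by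
    rw [← Set.range_comp]
    ext C
    constructor
    · rintro ⟨b, rfl⟩; exact ⟨b.vector, rfl⟩
    · rintro ⟨X, rfl⟩
      obtain ⟨b, hb⟩ := exists_superclass_orbit hF hδ X
      exact ⟨b, congrArg (fun O => cayley ⁻¹' O) hb⟩
  have hS : (Set.range fun b : BasicPair P δ => b.sigma ε) =
      (fun O => orbitSum ε (toDual '' O)) '' Set.range (orbit : lieU P F → Set (lieU P F)) := by
    rw [← Set.range_comp]
    ext χ
    constructor
    · rintro ⟨b, rfl⟩
      obtain ⟨Y, hY⟩ := (toDual_bijective hF).2 b.form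
      refine ⟨Y, ?_⟩
      change orbitSum ε (toDual '' orbit Y) = orbitSum ε (dualOrbit b.form)
      rw [← hY, dualOrbit_toDual]
    · rintro ⟨X, rfl⟩
      obtain ⟨b, hb⟩ := exists_dualOrbit_eq hF hδ X
      exact ⟨b, congrArg (orbitSum ε) hb⟩
  have hdisj : (Set.range (orbit : lieU P F → Set (lieU P F))).Pairwise
      fun O O' => Disjoint (toDual '' O) (toDual '' O') := by
    rintro _ ⟨X, rfl⟩ _ ⟨Y, rfl⟩ hne
    rw [Set.disjoint_image_iff (toDual_bijective hF).1, Set.disjoint_left]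
    exact fun Z hZ hZ' => hne ((orbit_eq_of_mem hZ).symm.trans (orbit_eq_of_mem hZ'))
  have hstable : ∀ X : lieU P F, IsStable (toDual '' orbit X) := fun X => by
    rw [← dualOrbit_toDual]; exact isStable_dualOrbit _
  have hnonempty : ∀ X : lieU P F, (toDual '' orbit X).Nonempty := fun X =>
    ⟨_, _, mem_orbit_self X, rfl⟩
  refine ⟨?_, ?_, ⟨?_, ?_⟩, ?_, ?_, ?_⟩
  · rw [hS]
    rintro _ ⟨_, ⟨X, rfl⟩, rfl⟩
    exact isCharacter_orbitSum hF hε (hstable X) (hnonempty X)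
  · rw [hS]
    rintro _ ⟨O, hO, rfl⟩ _ ⟨O', hO', rfl⟩ hne
    refine charDisjoint_of_sum_eq_zero (sum_orbitSum_mul_eq_zero hF hε (hdisj hO hO' ?_))
    rintro rfl
    exact hne rfl
  · rintro ⟨b, hb⟩
    obtain ⟨u, hu⟩ := hsurj b.vector
    have : u ∈ b.superclass := by
      change cayley u ∈ orbit b.vector
      rw [hu]
      exact mem_orbit_self _
    exact Set.eq_empty_iff_forall_notMem.1 hb u this
  · intro u
    rw [hK]
    refine ⟨cayley ⁻¹' orbit (cayley u), ⟨⟨_, ⟨_, rfl⟩, rfl⟩, mem_orbit_self _⟩, ?_⟩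
    rintro _ ⟨⟨_, ⟨X, rfl⟩, rfl⟩, hu⟩
    change cayley ⁻¹' orbit X = _
    rw [orbit_eq_of_mem hu]
  -- Both images of the set of orbits are taken under injective maps: preimage under a surjection,
  -- and the orbit sum of the dual orbit.
  · rw [hS, hK, Set.InjOn.encard_image, Set.InjOn.encard_image]
    · exact (Set.preimage_injective.2 hsurj).injOn
    · refine Set.InjOn.comp (t := (fun O => toDual '' O) '' Set.range orbit)
        (g := orbitSum ε) (f := fun O : Set (lieU P F) => toDual '' O) (orbitSum_injOn hF hε ?_ ?_)
        (Set.image_injective.2 (toDual_bijective hF).1).injOn (Set.mapsTo_image _ _)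
      · rintro _ ⟨O, hO, rfl⟩ _ ⟨O', hO', rfl⟩ hne
        refine hdisj hO hO' ?_
        rintro rfl
        exact hne rfl
      · rintro _ ⟨_, ⟨X, rfl⟩, rfl⟩
        exact hnonempty X
  · rw [hS, hK]
    rintro _ ⟨_, ⟨X, rfl⟩, rfl⟩ _ ⟨_, ⟨Y, rfl⟩, rfl⟩ u ⟨g, hg⟩ v ⟨h, hh⟩
    change orbitSum ε _ u = orbitSum ε _ v
    unfold orbitSum
    rw [hg, hh, finsum_conj (hstable X), finsum_conj (hstable X)]
  · rw [hK]
    refine ⟨orbit 0, ⟨0, rfl⟩, ?_⟩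
    ext u
    change cayley u ∈ orbit 0 ↔ _
    rw [orbit_zero, Set.mem_singleton_iff, Set.mem_singleton_iff, ← cayley_one hF,
      (cayley_injective hF).eq_iff]
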